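/- **Setting.** Let $\mathcal C,S,A$ be finite sets ($A\neq\emptyset$), $s_0,s_H\in S$ and $H\in\mathbb N$. A dynamics is a map $P(s'\mid s,a)\ge 0$ with $\sum_{s'\in S}P(s'\mid s,a)=1$; it is *layered* if $S$ is a disjoint union of layers $S_0,\dots,S_H$ with $s_0\in S_0$, $S_H=\{s_H\}$, and $P(s'\mid s,a)>0$, $s\in S_h$, $h<H$ imply $s'\in S_{h+1}$. For a deterministic policy $\pi:S\to A$ let $q_h(s\mid\pi,P)$ be the probability that the chain started at $s_0$ and following $\pi$ under $P$ is at $s$ at time $h$, and for $r:S\times A\to\mathbb R$ let $V^{\pi}_{(P,r)}=\mathbb E_{\pi,P}\big[\sum_{h=0}^{H-1}r(s_h,\pi(s_h))\big]$ be its value. A contextual MDP is given by a distribution $\mathcal D$ on $\mathcal C$ and, for each context $c$, a layered dynamics $P_\star^c$ with layers $S^c_0,\dots,S^c_H$ and, for each $(s,a)$, a reward law on $[0,1]$ with mean $r_\star^c(s,a)$. Assume minimum reachability with a known $p_{\min}\in(0,1]$: $q_h(s\mid\pi,P_\star^c)\ge p_{\min}$ for all $c$, all $h$, all $s\in S^c_h$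 and all $\pi:S\to A$. Let $\mathcal F$ be a finite class of functions $\mathcal C\times S\times A\to[0,1]$ containing $(c,s,a)\mapsto r_\star^c(s,a)$, and let $\mathcal P$ be a finite class of context-dependent dynamics $P=(P^c)_{c\in\mathcal C}$, each $P^c$ layered (possibly with layers of its own, but with the same $s_0$, $s_H$, $H$), containing $P_\star$. **Algorithm RM-UCDD.** Let $\delta\in(0,1)$ and $\beta_t=\sqrt{\frac{17t\log(8|\mathcal F|t^3/\delta)}{|S||A|}}$, $\gamma_t=\sqrt{\frac{18t\log(8|\mathcal P|t^3/\delta)}{|S||A|}}$. In each round $t$ the algorithm selects a context-dependent policy $\pi_t(c;\cdot):S\to A$; then $c_t\sim\mathcal D$ is drawn, independently of the past, and an episode $s^t_0,a^t_0,r^t_0,\dots,s^t_H$ of $\pi_t(c_t;\cdot)$ is observed, where $s^t_0=s_0$, $a^t_h=\pi_t(c_t;s^t_h)$, $s^t_{h+1}\sim P_\star^{c_t}(\cdot\mid s^t_h,a^t_h)$ and $r^t_h$ is drawn from the reward law of $(c_t,s^t_h,a^t_h)$. In round $t\le|A|$, $\pi_t$ always plays the $t$-th action. In round $t>|A|$,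 least-squares oracles return $$\hat f_t\in\arg\min_{f\in\mathcal F}\sum_{i<t}\sum_{h<H}\big(f(c_i,s^i_h,a^i_h)-r^i_h\big)^2,\qquad \hat P_t\in\arg\min_{P\in\mathcal P}\sum_{i<t}\sum_{h<H}\sum_{s'\in S}\big(P^{c_i}(s'\mid s^i_h,a^i_h)-\mathbb 1[s'=s^i_{h+1}]\big)^2,$$ and $\pi_t(c;\cdot)\in\arg\max_{\pi:S\to A}V^\pi_{(\hat P_t^c,\hat r_t^c)}$ is computed by a planning algorithm, where $$\hat r^c_t(s,a)=\hat f_t(c,s,a)+\frac{\beta_t+H|S|\gamma_t}{p_{\min}\,\#\{i<t:\pi_i(c;s)=a\}}.$$ **Theorem.** Let $\pi^\star(c;\cdot)\in\arg\max_{\pi} V^{\pi}_{(P_\star^c,r_\star^c)}$ for every $c$, let $\mathrm{Regret}_T=\sum_{t=1}^T\big(V^{\pi^\star(c_t;\cdot)}_{(P_\star^{c_t},r_\star^{c_t})}-V^{\pi_t(c_t;\cdot)}_{(P_\star^{c_t},r_\star^{c_t})}\big)$, and write $\log_+x=\max\{1,\log x\}$. There are absolute constants $K>0$ and $k\in\mathbb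 N$ such that in the above setting, for every $T\ge1$, with probability at least $1-\delta$, $$\mathrm{Regret}_T\le K(1+\log T)^k\Big[\Big(H+\tfrac1{p_{\min}}\Big)\Big(H|S|^{3/2}\sqrt{|A|T\log_+\tfrac{|\mathcal P|}{\delta}}+\sqrt{T|S||A|\log_+\tfrac{|\mathcal F|}{\delta}}\Big)+|A|H\Big].$$ If moreover $\mathcal F=\mathcal G^S$ for a finite class $\mathcal G$ of functions $\mathcal C\times A\to[0,1]$, that is, $\mathcal F$ consists of all $f$ with $f(\cdot,s,\cdot)\in\mathcal G$ for every $s\in S$, then with probability at least $1-\delta$, $$\mathrm{Regret}_T\le K(1+\log T)^k\Big[\Big(H+\tfrac1{p_{\min}}\Big)\Big(H|S|^{3/2}\sqrt{T|A|\log_+\tfrac{|\mathcal P|}{\delta}}+|S|\sqrt{T|A|\log_+\tfrac{|\mathcal G|}{\delta}}\Big)+|A|H\Big],$$ and also with probability at least $1-\delta$, $$\mathrm{Regret}_T\le K(1+\log T)^k\Big(H+\tfrac1{p_{\min}}\Big)H|S|^{3/2}\sqrt{|A|T\log_+\tfrac{\max\{|\mathcal G|,|\mathcal P|\}}{\delta}}.$$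 -/

import Mathlib

open MeasureTheory

noncomputable section

namespace UCDD

/-- An observed episode: the context, the visited states `s_0, …, s_H`, the played actions
`a_0, …, a_{H-1}` and the observed rewards `r_0, …, r_{H-1}`. -/
abbrev Traj (C S A : Type*) (H : ℕ) : Type _ :=
  C × (Fin (H + 1) → S) × (Fin H → A) × (Fin H → ℝ)

/-- `P s a s'` is the probability of moving to `s'` when `a` is played in `s`. -/
def IsTransition {S A : Type*} [Fintype S] (P : S → A → S → ℝ) : Prop :=
  (∀ s a s', 0 ≤ P s a s') ∧ ∀ s a, ∑ s', P s a s' = 1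

/-- `layer` decomposes the states into layers `0, …, H`: the start state is in layer `0`, the final
layer consists of `sH` alone, and from a state before the final layer one moves only to the next
layer. -/
def IsLayering {S A : Type*} {H : ℕ} (s0 sH : S) (P : S → A → S → ℝ)
    (layer : S → Fin (H + 1)) : Prop :=
  layer s0 = 0 ∧ (∀ s, layer s = Fin.last H ↔ s = sH) ∧
    ∀ s a s', s ≠ sH → P s a s' ≠ 0 → (layer s' : ℕ) = layer s + 1

/-- Probability of the state sequence `x` when the deterministic policy `π` is played from `s0`
under the dynamics `P`. -/
def pathProb {S A : Type*} [DecidableEq S] {H : ℕ} (s0 : S) (P : S → A → S → ℝ) (π : S → A)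
    (x : Fin (H + 1) → S) : ℝ :=
  (if x 0 = s0 then 1 else 0) *
    ∏ h : Fin H, P (x h.castSucc) (π (x h.castSucc)) (x h.succ)

/-- Occupancy measure `q_h(s | π, P)`: the probability of being in `s` at time `h`. -/
def occupancy {S A : Type*} [Fintype S] [DecidableEq S] {H : ℕ} (s0 : S) (P : S → A → S → ℝ)
    (π : S → A) (h : Fin (H + 1)) (s : S) : ℝ :=
  ∑ x : Fin (H + 1) → S, if x h = s then pathProb s0 P π x else 0

/-- The value `V^π_M(s_0)` of the MDP `M = (S, A, P, r, s_0, H)`: the expected sum of the rewards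
`r(s_h, π(s_h))` over `h = 0, …, H - 1`. -/
def value {S A : Type*} [Fintype S] [DecidableEq S] (H : ℕ) (s0 : S) (P : S → A → S → ℝ)
    (r : S → A → ℝ) (π : S → A) : ℝ :=
  ∑ x : Fin (H + 1) → S,
    pathProb s0 P π x * ∑ h : Fin H, r (x h.castSucc) (π (x h.castSucc))

/-- A layered contextual MDP with finite horizon `H` and context-dependent dynamics and rewards. -/
structure CMDP (C S A : Type*) [Fintype S] (H : ℕ) where
  /-- distribution of the contexts -/
  ctx : PMF C
  /-- start state -/
  s0 : S
  /-- final state -/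
  sH : S
  /-- true dynamics -/
  dyn : C → S → A → S → ℝ
  /-- layer of a state, for each context -/
  layer : C → S → Fin (H + 1)
  /-- law of the random reward of an action in a state -/
  rew : C → S → A → Measure ℝ
  isTransition : ∀ c, IsTransition (dyn c)
  isLayering : ∀ c, IsLayering s0 sH (dyn c) (layer c)
  isProb_rew : ∀ c s a, IsProbabilityMeasure (rew c s a)
  rew_mem : ∀ c s a, ∀ᵐ x ∂(rew c s a), x ∈ Set.Icc (0 : ℝ) 1

namespace CMDP

variable {C S A : Type*} [Fintype S] {H : ℕ}

/-- Expected reward. -/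
def meanRew (M : CMDP C S A H) (c : C) (s : S) (a : A) : ℝ := ∫ x, x ∂(M.rew c s a)

/-- Value of the policy `π` in the MDP of the context `c`. -/
def val [DecidableEq S] (M : CMDP C S A H) (c : C) (π : S → A) : ℝ :=
  value H M.s0 (M.dyn c) (M.meanRew c) π

/-- Under every deterministic policy, every state is visited with probability at least `pmin`
at the time of its layer. -/
def MinReach [DecidableEq S] (M : CMDP C S A H) (pmin : ℝ) : Prop :=
  ∀ (c : C) (π : S → A) (s : S), pmin ≤ occupancy M.s0 (M.dyn c) π (M.layer c s) s

/-- A deterministic context-dependent policy that is optimal for every context. -/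
def IsOptimal [DecidableEq S] (M : CMDP C S A H) (πs : C → S → A) : Prop :=
  ∀ (c : C) (π : S → A), M.val c π ≤ M.val c (πs c)

/-- Law of an episode in which the context-dependent policy `π` is played: the context is drawn
from the context distribution, the states follow the dynamics of this context, and, given these,
the rewards are drawn independently from the reward laws of the visited state-action pairs. -/
def episodeLaw [Fintype C] [DecidableEq S] [MeasurableSpace C] [MeasurableSpace S]
    [MeasurableSpace A] (M : CMDP C S A H) (π : C → S → A) : Measure (Traj C S A H) :=
  ∑ c : C, ∑ x : Fin (H + 1) → S,
    (M.ctx c * ENNReal.ofReal (pathProb M.s0 (M.dyn c) (π c) x)) •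
      (Measure.pi fun h : Fin H => M.rew c (x h.castSucc) (π c (x h.castSucc))).map
        fun r => (c, x, (fun h => π c (x h.castSucc)), r)

end CMDP

/-- Least-squares objective for the rewards on `n` observed episodes. -/
def rewLoss {C S A : Type*} {H n : ℕ} (f : C → S → A → ℝ) (σ : Fin n → Traj C S A H) : ℝ :=
  ∑ i, ∑ h : Fin H,
    (f (σ i).1 ((σ i).2.1 h.castSucc) ((σ i).2.2.1 h) - (σ i).2.2.2 h) ^ 2

/-- Least-squares objective for the dynamics on `n` observed episodes. -/
def dynLoss {C S A : Type*} [Fintype S] [DecidableEq S] {H n : ℕ} (P : C → S → A → S → ℝ)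
    (σ : Fin n → Traj C S A H) : ℝ :=
  ∑ i, ∑ h : Fin H, ∑ s' : S,
    (P (σ i).1 ((σ i).2.1 h.castSucc) ((σ i).2.2.1 h) s'
      - if s' = (σ i).2.1 h.succ then 1 else 0) ^ 2

/-- Least-squares regression oracle for the reward class `F`: from the observed episodes it
computes (measurably) a minimizer over `F` of the least-squares objective. -/
def IsRewOracle {C S A : Type*} [MeasurableSpace C] [MeasurableSpace S] [MeasurableSpace A] {H : ℕ}
    (F : Finset (C → S → A → ℝ))
    (o : (n : ℕ) → (Fin n → Traj C S A H) → C → S → A → ℝ) : Prop :=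
  ∀ n, Measurable (o n) ∧ ∀ σ, o n σ ∈ F ∧ ∀ f ∈ F, rewLoss (o n σ) σ ≤ rewLoss f σ

/-- Least-squares regression oracle for the dynamics class `Fp`. -/
def IsDynOracle {C S A : Type*} [Fintype S] [DecidableEq S] [MeasurableSpace C]
    [MeasurableSpace S] [MeasurableSpace A] {H : ℕ} (Fp : Finset (C → S → A → S → ℝ))
    (o : (n : ℕ) → (Fin n → Traj C S A H) → C → S → A → S → ℝ) : Prop :=
  ∀ n, Measurable (o n) ∧ ∀ σ, o n σ ∈ Fp ∧ ∀ P ∈ Fp, dynLoss (o n σ) σ ≤ dynLoss P σ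

/-- Planning: from the dynamics and the rewards of an MDP, compute an optimal policy. -/
def IsPlanner {S A : Type*} [Fintype S] [DecidableEq S] (H : ℕ) (s0 : S)
    (plan : (S → A → S → ℝ) → (S → A → ℝ) → S → A) : Prop :=
  ∀ P r π, value H s0 P r π ≤ value H s0 P r (plan P r)

/-- What algorithm RM-UCDD works with: an enumeration `a_1, …, a_{|A|}` of the actions, the two
regression oracles, the planning algorithm, the reachability parameter and the tuning parameters
(indexed by the rounds `t = 1, 2, …`). -/
structure Alg (C S A : Type*) [Fintype A] (H : ℕ) where
  enum : Fin (Fintype.card A) ≃ A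
  rewOracle : (n : ℕ) → (Fin n → Traj C S A H) → C → S → A → ℝ
  dynOracle : (n : ℕ) → (Fin n → Traj C S A H) → C → S → A → S → ℝ
  plan : (S → A → S → ℝ) → (S → A → ℝ) → S → A
  pmin : ℝ
  β : ℕ → ℝ
  γ : ℕ → ℝ

namespace Alg

variable {C S A : Type*} [Fintype S] [Fintype A] [DecidableEq A] {H : ℕ}

/-- The policies `π_1(c; ·), π_2(c; ·), …` that the algorithm computes for the context `c` from the
sequences of the regression estimates. The index `n` stands for round `t = n + 1`. In the first
`|A|` rounds one action is played everywhere; later the planner is run on the estimated dynamics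
and on the estimated rewards increased by
`(β_t + H |S| γ_t) / (pmin * #{i < t | π_i(c; s) = a})`. -/
def policySeq (𝒜 : Alg C S A H) (fhat : ℕ → C → S → A → ℝ) (Phat : ℕ → C → S → A → S → ℝ)
    (c : C) (n : ℕ) : S → A :=
  if hn : n < Fintype.card A then fun _ => 𝒜.enum ⟨n, hn⟩
  else
    𝒜.plan (Phat n c) fun s a =>
      fhat n c s a +
        (𝒜.β (n + 1) + H * Fintype.card S * 𝒜.γ (n + 1)) /
          (𝒜.pmin * ∑ i : Fin n, if a = 𝒜.policySeq fhat Phat c i s then (1 : ℝ) else 0)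
termination_by n
decreasing_by exact i.2

/-- The context-dependent policy of round `n + 1`, given the `n` episodes observed before. The
estimates of round `i + 1` are computed from the first `i` episodes. -/
def policy (𝒜 : Alg C S A H) {n : ℕ} (σ : Fin n → Traj C S A H) : C → S → A := fun c =>
  𝒜.policySeq
    (fun i => if hi : i ≤ n then 𝒜.rewOracle i (fun j => σ (Fin.castLE hi j)) else 0)
    (fun i => if hi : i ≤ n then 𝒜.dynOracle i (fun j => σ (Fin.castLE hi j)) else 0)
    c n

variable [Fintype C] [DecidableEq S] [MeasurableSpace C] [MeasurableSpace S] [MeasurableSpace A]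

/-- Joint law of the first `n` episodes when the algorithm interacts with the contextual MDP `M`:
given the episodes observed so far, the next one is drawn from the episode law of the policy
selected by the algorithm. -/
def historyLaw (𝒜 : Alg C S A H) (M : CMDP C S A H) : (n : ℕ) → Measure (Fin n → Traj C S A H)
  | 0 => Measure.dirac Fin.elim0
  | n + 1 => (𝒜.historyLaw M n).bind fun σ =>
      (M.episodeLaw (𝒜.policy σ)).map fun τ => Fin.snoc (α := fun _ => Traj C S A H) σ τ

/-- Regret over `T` rounds with respect to `πs`. -/
def regret (𝒜 : Alg C S A H) (M : CMDP C S A H) (πs : C → S → A) {T : ℕ}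
    (σ : Fin T → Traj C S A H) : ℝ :=
  ∑ t : Fin T,
    (M.val (σ t).1 (πs (σ t).1)
      - M.val (σ t).1 (𝒜.policy (fun j : Fin t => σ (Fin.castLE t.2.le j)) (σ t).1))

end Alg

/-- `β_t = sqrt (17 t log (8 |F| t³ / δ) / (|S| |A|))`, for `nF = |F|` and so on. -/
def betaParam (nF nS nA : ℕ) (δ : ℝ) (t : ℕ) : ℝ :=
  √(17 * t * Real.log (8 * nF * (t : ℝ) ^ 3 / δ) / (nS * nA))

/-- `γ_t = sqrt (18 t log (8 |Fp| t³ / δ) / (|S| |A|))`. -/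
def gammaParam (nP nS nA : ℕ) (δ : ℝ) (t : ℕ) : ℝ :=
  √(18 * t * Real.log (8 * nP * (t : ℝ) ^ 3 / δ) / (nS * nA))

/-- The logarithmic factor `log x`, read as at least `1`. -/
def logp (x : ℝ) : ℝ := max 1 (Real.log x)

end UCDD

end

/-!
Under every policy, every state of every context is visited with probability at least `pmin`, so a
round informs about all the actions that its policy selects, whether or not they are played. Hence
the squared errors of an estimate at the pairs `(s, π s)`, each multiplied by `pmin` and by the
number of past selections of the action, sum to at most the expected squared error along the past
episodes. By the inequality of arithmetic and geometric means an error is at most the bonus plus a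
multiple of its weighted square. The estimated MDP is therefore optimistic up to the weighted
squares, and the regret of a round is at most twice the bonuses of the played policy plus twice
this slack.

The expected squared errors of the least-squares estimates sum to at most a logarithm: half of the
expected squared error minus the excess squared loss has, after scaling, exponential moment at most
one in every episode, so Markov's inequality applies to the product over the rounds, with a union
bound over the class. The inverse numbers of selections at the selected actions sum to at most
`|A| (1 + log T)` for each state, since each selection raises a number by one.
-/

noncomputable section

namespace UCDD

section Paths

/-- Expectation of `φ` over the state sequences of the policy `π` under the dynamics `P`. -/
def pathMean {S A : Type*} [Fintype S] [DecidableEq S] {H : ℕ} (s0 : S) (P : S → A → S → ℝ)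
    (π : S → A) (φ : (Fin (H + 1) → S) → ℝ) : ℝ :=
  ∑ x, pathProb s0 P π x * φ x

theorem pathProb_nonneg {S A : Type*} [Fintype S] [DecidableEq S] {H : ℕ} {P : S → A → S → ℝ}
    (hP : IsTransition P) (s : S) (π : S → A) (x : Fin (H + 1) → S) : 0 ≤ pathProb s P π x :=
  mul_nonneg (by split_ifs <;> norm_num) (Finset.prod_nonneg fun _ _ => hP.1 _ _ _)

theorem start_eq_of_pathProb_ne_zero {S A : Type*} [DecidableEq S] {H : ℕ} {s0 : S}
    {P : S → A → S → ℝ} {π : S → A} {x : Fin (H + 1) → S} (hx : pathProb s0 P π x ≠ 0) :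
    x 0 = s0 := by
  by_contra hne
  exact hx (by rw [pathProb, if_neg hne, zero_mul])

theorem layer_eq_of_pathProb_ne_zero {S A : Type*} [DecidableEq S] {H : ℕ}
    {s0 sH : S} {P : S → A → S → ℝ} {layer : S → Fin (H + 1)}
    (hl : IsLayering s0 sH P layer) {π : S → A} {x : Fin (H + 1) → S}
    (hx : pathProb s0 P π x ≠ 0) (h : Fin (H + 1)) : layer (x h) = h := by
  have hstep (h : Fin H) : P (x h.castSucc) (π (x h.castSucc)) (x h.succ) ≠ 0 := fun hne =>
    hx (by rw [pathProb, Finset.prod_eq_zero (Finset.mem_univ h) hne, mul_zero])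
  induction h using Fin.induction with
  | zero => rw [start_eq_of_pathProb_ne_zero hx, hl.1]
  | succ h ih =>
    have hne : x h.castSucc ≠ sH := fun he =>
      (Fin.castSucc_lt_last h).ne (ih.symm.trans ((hl.2.1 _).2 he))
    have hlayer := hl.2.2 _ _ _ hne (hstep h)
    rw [ih] at hlayer
    exact Fin.ext (by simpa using hlayer)

variable {S A : Type*} [Fintype S] [DecidableEq S]

theorem pathMean_zero (s : S) (P : S → A → S → ℝ) (π : S → A) (φ : (Fin (0 + 1) → S) → ℝ) :
    pathMean s P π φ = φ fun _ => s := by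
  rw [pathMean, Finset.sum_eq_single fun _ => s]
  · simp [pathProb]
  · intro x _ hx
    have hx0 : x 0 ≠ s := fun h => hx (by ext i; rw [Fin.fin_one_eq_zero i, h])
    simp [pathProb, hx0]
  · simp

theorem pathMean_succ {k : ℕ} (s : S) (P : S → A → S → ℝ) (π : S → A)
    (φ : (Fin (k + 1 + 1) → S) → ℝ) :
    pathMean s P π φ =
      ∑ s', P s (π s) s' * pathMean s' P π fun y => φ (Fin.cons (α := fun _ => S) s y) := by
  rw [pathMean, ← (Fin.consEquiv (fun _ : Fin (k + 1 + 1) => S)).sum_comp,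
    Fintype.sum_prod_type, Finset.sum_eq_single s]
  · simp_rw [pathMean, Finset.mul_sum]
    rw [Finset.sum_comm]
    refine Finset.sum_congr rfl fun y _ => ?_
    rw [Finset.sum_eq_single (y 0)]
    · simp only [pathProb, Fin.consEquiv_apply, Fin.cons_zero, if_true, one_mul,
        Fin.prod_univ_succ, Fin.castSucc_zero, Fin.cons_succ, Fin.castSucc_succ, mul_assoc]
      rfl
    · intro b _ hb
      simp [pathProb, hb.symm]
    · simp
  · intro b _ hb
    simp [pathProb, hb]
  · simp

theorem pathMean_add {H : ℕ} (s : S) (P : S → A → S → ℝ) (π : S → A)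
    (φ ψ : (Fin (H + 1) → S) → ℝ) :
    pathMean s P π (fun x => φ x + ψ x) = pathMean s P π φ + pathMean s P π ψ := by
  simp only [pathMean, mul_add, Finset.sum_add_distrib]

theorem pathMean_const_mul {H : ℕ} (s : S) (P : S → A → S → ℝ) (π : S → A) (b : ℝ)
    (φ : (Fin (H + 1) → S) → ℝ) :
    pathMean s P π (fun x => b * φ x) = b * pathMean s P π φ := by
  simp only [pathMean, mul_left_comm _ b, Finset.mul_sum]

theorem pathMean_const {P : S → A → S → ℝ} (hP : IsTransition P) (H : ℕ) (s : S) (π : S → A)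
    (b : ℝ) : pathMean (H := H) s P π (fun _ => b) = b := by
  induction H generalizing s with
  | zero => rw [pathMean_zero]
  | succ k ih => rw [pathMean_succ]; simp only [ih, ← Finset.sum_mul, hP.2, one_mul]

theorem pathMean_le_pathMean {P : S → A → S → ℝ} (hP : IsTransition P) {H : ℕ} {s : S}
    {π : S → A} {φ ψ : (Fin (H + 1) → S) → ℝ}
    (h : ∀ x, pathProb s P π x ≠ 0 → φ x ≤ ψ x) : pathMean s P π φ ≤ pathMean s P π ψ := by
  refine Finset.sum_le_sum fun x _ => ?_
  by_cases hx : pathProb s P π x = 0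
  · simp [hx]
  · exact mul_le_mul_of_nonneg_left (h x hx) (pathProb_nonneg hP s π x)

theorem pathMean_start {P : S → A → S → ℝ} (hP : IsTransition P) (k : ℕ) (s : S)
    (π : S → A) (u : S → ℝ) : pathMean (H := k) s P π (fun x => u (x 0)) = u s := by
  refine Eq.trans (Finset.sum_congr rfl fun x _ => ?_) (pathMean_const hP k s π (u s))
  by_cases hx : pathProb s P π x = 0
  · simp only [hx, zero_mul]
  · simp only [start_eq_of_pathProb_ne_zero hx]

theorem value_eq_pathMean (k : ℕ) (s : S) (P : S → A → S → ℝ) (r : S → A → ℝ) (π : S → A) :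
    value k s P r π = pathMean s P π fun x => ∑ h : Fin k, r (x h.castSucc) (π (x h.castSucc)) :=
  rfl

theorem value_zero (s : S) (P : S → A → S → ℝ) (r : S → A → ℝ) (π : S → A) :
    value 0 s P r π = 0 := by
  simp [value]

theorem value_add (k : ℕ) (s : S) (P : S → A → S → ℝ) (r q : S → A → ℝ) (π : S → A) :
    value k s P (fun s a => r s a + q s a) π = value k s P r π + value k s P q π := by
  simp only [value_eq_pathMean, Finset.sum_add_distrib, pathMean_add]

theorem value_sub (k : ℕ) (s : S) (P : S → A → S → ℝ) (r q : S → A → ℝ) (π : S → A) :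
    value k s P (fun s a => r s a - q s a) π = value k s P r π - value k s P q π := by
  rw [eq_sub_iff_add_eq, ← value_add]
  simp only [sub_add_cancel]

variable {P Q : S → A → S → ℝ}

theorem pathMean_sum_transition (hP : IsTransition P) {k : ℕ} (s : S) (π : S → A)
    (φ : S → S → ℝ) :
    pathMean s P π (fun x => ∑ h : Fin k, φ (x h.castSucc) (x h.succ)) =
      value k s P (fun s a => ∑ s', P s a s' * φ s s') π := by
  induction k generalizing s with
  | zero => simp [pathMean, value]
  | succ k ih =>
    simp only [value_eq_pathMean] at ih ⊢
    simp only [pathMean_succ (k := k), Fin.sum_univ_succ (n := k), Fin.castSucc_zero,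
      Fin.cons_zero, Fin.cons_succ, Fin.castSucc_succ, pathMean_add, pathMean_const hP,
      pathMean_start hP k _ π (φ s), ih, mul_add, Finset.sum_add_distrib]
    rw [← Finset.sum_mul, hP.2, one_mul]

theorem value_succ (hP : IsTransition P) (k : ℕ) (s : S) (r : S → A → ℝ) (π : S → A) :
    value (k + 1) s P r π = r s (π s) + ∑ s', P s (π s) s' * value k s' P r π := by
  simp only [value_eq_pathMean, pathMean_succ (k := k), Fin.sum_univ_succ (n := k),
    Fin.castSucc_zero, Fin.cons_zero, Fin.cons_succ, Fin.castSucc_succ, pathMean_add,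
    pathMean_const hP, mul_add, Finset.sum_add_distrib]
  rw [← Finset.sum_mul, hP.2, one_mul]

theorem value_le_value (hP : IsTransition P) (k : ℕ) (s : S) {r q : S → A → ℝ} {π : S → A}
    (h : ∀ s, r s (π s) ≤ q s (π s)) : value k s P r π ≤ value k s P q π :=
  pathMean_le_pathMean hP fun _ _ => Finset.sum_le_sum fun _ _ => h _

theorem value_nonneg (hP : IsTransition P) (k : ℕ) (s : S) {r : S → A → ℝ}
    (hr : ∀ s a, 0 ≤ r s a) (π : S → A) : 0 ≤ value k s P r π :=
  Finset.sum_nonneg fun x _ => mul_nonneg (pathProb_nonneg hP s π x)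
    (Finset.sum_nonneg fun _ _ => hr _ _)

theorem value_le (hP : IsTransition P) (k : ℕ) (s : S) {r : S → A → ℝ}
    (hr : ∀ s a, r s a ≤ 1) (π : S → A) : value k s P r π ≤ k := by
  refine (value_le_value (q := fun _ _ => 1) hP k s fun s => hr s (π s)).trans_eq ?_
  simp only [value_eq_pathMean, pathMean_const hP, Finset.sum_const, Finset.card_univ,
    Fintype.card_fin, nsmul_eq_mul, mul_one]

theorem abs_sum_sub_mul_le {ι : Type*} [Fintype ι] {p q u : ι → ℝ} {B : ℝ}
    (hu : ∀ i, |u i| ≤ B) : |∑ i, (p i - q i) * u i| ≤ B * ∑ i, |p i - q i| := by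
  refine (Finset.abs_sum_le_sum_abs _ _).trans ?_
  rw [Finset.mul_sum]
  refine Finset.sum_le_sum fun i _ => ?_
  rw [abs_mul, mul_comm]
  exact mul_le_mul_of_nonneg_right (hu i) (abs_nonneg _)

theorem abs_value_sub_value_le (hP : IsTransition P) (hQ : IsTransition Q) {q : S → A → ℝ}
    {π : S → A} {B : ℝ} (k : ℕ) (s : S) (hB : ∀ j < k, ∀ s, |value j s Q q π| ≤ B) :
    |value k s P q π - value k s Q q π| ≤
      value k s P (fun s a => B * ∑ s', |P s a s' - Q s a s'|) π := by
  induction k generalizing s with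
  | zero => simp [value_zero]
  | succ k ih =>
    have hdiff : value (k + 1) s P q π - value (k + 1) s Q q π =
        ∑ s', (P s (π s) s' - Q s (π s) s') * value k s' Q q π +
          ∑ s', P s (π s) s' * (value k s' P q π - value k s' Q q π) := by
      rw [value_succ hP, value_succ hQ, ← Finset.sum_add_distrib, add_sub_add_left_eq_sub,
        ← Finset.sum_sub_distrib]
      exact Finset.sum_congr rfl fun _ _ => by ring
    rw [hdiff, value_succ hP]
    refine (abs_add_le _ _).trans (add_le_add (abs_sum_sub_mul_le (hB k k.lt_succ_self)) ?_)
    refine (Finset.abs_sum_le_sum_abs _ _).trans (Finset.sum_le_sum fun s' _ => ?_)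
    rw [abs_mul, abs_of_nonneg (hP.1 _ _ _)]
    exact mul_le_mul_of_nonneg_left (ih s' fun j hj => hB j (by omega)) (hP.1 _ _ _)

variable {H : ℕ} {s0 sH : S} {layer : S → Fin (H + 1)}

-- The states before the final one lie in distinct layers, so each of them is visited at most once.
theorem value_le_sum (hP : IsTransition P) (hl : IsLayering s0 sH P layer) {r : S → A → ℝ}
    {π : S → A} {G : S → ℝ} (hG : ∀ s, 0 ≤ G s) (hr : ∀ s, s ≠ sH → r s (π s) ≤ G s) :
    value H s0 P r π ≤ ∑ s ∈ Finset.univ.erase sH, G s := by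
  refine (pathMean_le_pathMean hP fun x hx => ?_).trans_eq (pathMean_const hP H s0 π _)
  have hlay := layer_eq_of_pathProb_ne_zero hl hx
  have hne (h : Fin H) : x h.castSucc ≠ sH := fun he =>
    (Fin.castSucc_lt_last h).ne ((hlay _).symm.trans ((hl.2.1 _).2 he))
  have hinj : Function.Injective fun h : Fin H => x h.castSucc := fun a b hab => by
    simpa only [hlay, Fin.castSucc_inj] using congrArg layer hab
  calc ∑ h : Fin H, r (x h.castSucc) (π (x h.castSucc))
      ≤ ∑ h : Fin H, G (x h.castSucc) := Finset.sum_le_sum fun h _ => hr _ (hne h)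
    _ = ∑ s ∈ Finset.univ.image fun h : Fin H => x h.castSucc, G s :=
        (Finset.sum_image fun a _ b _ hab => hinj hab).symm
    _ ≤ ∑ s ∈ Finset.univ.erase sH, G s := by
        refine Finset.sum_le_sum_of_subset_of_nonneg ?_ fun s _ _ => hG s
        intro s hs
        obtain ⟨h, -, rfl⟩ := Finset.mem_image.1 hs
        exact Finset.mem_erase.2 ⟨hne h, Finset.mem_univ _⟩

theorem occupancy_mul_eq_pathMean (π : S → A) (h : Fin (H + 1)) (s : S) (b : ℝ) :
    occupancy s0 P π h s * b = pathMean s0 P π fun x => if x h = s then b else 0 := by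
  simp only [occupancy, pathMean, Finset.sum_mul, ite_mul, zero_mul, mul_ite, mul_zero]

theorem mul_sum_le_value (hP : IsTransition P) (hl : IsLayering s0 sH P layer)
    {r : S → A → ℝ} {π : S → A} (hr : ∀ s a, 0 ≤ r s a) {p : ℝ}
    (hp : ∀ s, p ≤ occupancy s0 P π (layer s) s) :
    p * ∑ s ∈ Finset.univ.erase sH, r s (π s) ≤ value H s0 P r π := by
  have hvisit (x : Fin (H + 1) → S) :
      ∑ s ∈ Finset.univ.erase sH, (if x (layer s) = s then r s (π s) else 0) ≤
        ∑ h : Fin H, r (x h.castSucc) (π (x h.castSucc)) := by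
    rw [← Finset.sum_filter]
    have hsub : (Finset.univ.erase sH).filter (fun s => x (layer s) = s) ⊆
        Finset.univ.image fun h : Fin H => x h.castSucc := by
      intro s hs
      simp only [Finset.mem_filter, Finset.mem_erase, Finset.mem_univ, and_true] at hs
      have hlast : layer s ≠ Fin.last H := fun he => hs.1 ((hl.2.1 s).1 he)
      exact Finset.mem_image.2 ⟨(layer s).castPred hlast, Finset.mem_univ _, by simpa using hs.2⟩
    exact (Finset.sum_le_sum_of_subset_of_nonneg hsub fun s _ _ => hr _ _).trans
      (Finset.sum_image_le_of_nonneg fun _ _ => hr _ _)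
  calc p * ∑ s ∈ Finset.univ.erase sH, r s (π s)
      ≤ ∑ s ∈ Finset.univ.erase sH, occupancy s0 P π (layer s) s * r s (π s) := by
        rw [Finset.mul_sum]
        exact Finset.sum_le_sum fun s _ => mul_le_mul_of_nonneg_right (hp s) (hr _ _)
    _ = pathMean s0 P π fun x =>
          ∑ s ∈ Finset.univ.erase sH, if x (layer s) = s then r s (π s) else 0 := by
        simp only [occupancy_mul_eq_pathMean, pathMean, Finset.mul_sum]
        exact Finset.sum_comm
    _ ≤ value H s0 P r π := pathMean_le_pathMean hP fun x _ => hvisit x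

end Paths

section Optimism

variable {S A : Type*} [Fintype S] [DecidableEq S] {H : ℕ} {s0 sH : S} {P Q : S → A → S → ℝ}
  {layer : S → Fin (H + 1)} {f q b : S → A → ℝ} {π : S → A} {e : S → ℝ}

theorem abs_value_sub_value_le_of_mem_Icc (hP : IsTransition P) (hQ : IsTransition Q)
    (hq : ∀ s a, q s a ∈ Set.Icc 0 1) :
    |value H s0 P q π - value H s0 Q q π| ≤
      value H s0 P (fun s a => H * ∑ s', |P s a s' - Q s a s'|) π :=
  abs_value_sub_value_le hP hQ H s0 fun j hj s => by
    rw [abs_of_nonneg (value_nonneg hQ j s (fun s a => (hq s a).1) π)]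
    exact (value_le hQ j s (fun s a => (hq s a).2) π).trans (by exact_mod_cast hj.le)

/-- The error of the model `(P, f)` of the MDP `(Q, q)` in the action `a` of the state `s`. The
factor `H` is the largest value with rewards in `[0, 1]`. -/
def modelError (H : ℕ) (P Q : S → A → S → ℝ) (f q : S → A → ℝ) (s : S) (a : A) : ℝ :=
  |f s a - q s a| + H * ∑ s', |P s a s' - Q s a s'|

theorem value_le_value_add_sum (hP : IsTransition P) (hl : IsLayering s0 sH P layer)
    (hQ : IsTransition Q) (hq : ∀ s a, q s a ∈ Set.Icc 0 1) (he : ∀ s, 0 ≤ e s)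
    (herr : ∀ s, s ≠ sH → modelError H P Q f q s (π s) ≤ b s (π s) + e s) :
    value H s0 Q q π ≤
      value H s0 P (fun s a => f s a + b s a) π + ∑ s ∈ Finset.univ.erase sH, e s := by
  have hsim := neg_le_of_abs_le
    (abs_value_sub_value_le_of_mem_Icc (H := H) (s0 := s0) (π := π) hP hQ hq)
  have hsum : value H s0 P (fun s a => q s a - (f s a + b s a) +
      H * ∑ s', |P s a s' - Q s a s'|) π ≤ ∑ s ∈ Finset.univ.erase sH, e s :=
    value_le_sum hP hl he fun s hs => by
      linarith [herr s hs, neg_abs_le (f s (π s) - q s (π s)), modelError.eq_def H P Q f q s (π s)]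
  rw [value_add, value_sub] at hsum
  linarith

theorem value_add_le_value_add_sum (hP : IsTransition P) (hl : IsLayering s0 sH P layer)
    (hQ : IsTransition Q) (hq : ∀ s a, q s a ∈ Set.Icc 0 1) (hb : ∀ s, 0 ≤ b s (π s))
    (he : ∀ s, 0 ≤ e s) (herr : ∀ s, s ≠ sH → modelError H P Q f q s (π s) ≤ b s (π s) + e s) :
    value H s0 P (fun s a => f s a + b s a) π ≤
      value H s0 Q q π + ∑ s ∈ Finset.univ.erase sH, (2 * b s (π s) + e s) := by
  have hsim := le_of_abs_le
    (abs_value_sub_value_le_of_mem_Icc (H := H) (s0 := s0) (π := π) hP hQ hq)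
  have hsum : value H s0 P (fun s a => f s a + b s a - q s a +
      H * ∑ s', |P s a s' - Q s a s'|) π ≤ ∑ s ∈ Finset.univ.erase sH, (2 * b s (π s) + e s) :=
    value_le_sum hP hl (fun s => by linarith [hb s, he s]) fun s hs => by
      linarith [herr s hs, le_abs_self (f s (π s) - q s (π s)), modelError.eq_def H P Q f q s (π s)]
  rw [value_add, value_sub] at hsum
  linarith

theorem value_sub_value_le_of_optimistic {e : S → A → ℝ} {π' : S → A} (hP : IsTransition P)
    (hl : IsLayering s0 sH P layer) (hQ : IsTransition Q) (hq : ∀ s a, q s a ∈ Set.Icc 0 1)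
    (hb : ∀ s a, 0 ≤ b s a) (he : ∀ s a, 0 ≤ e s a)
    (herr : ∀ s a, s ≠ sH → modelError H P Q f q s a ≤ b s a + e s a)
    (hplan : value H s0 P (fun s a => f s a + b s a) π ≤
      value H s0 P (fun s a => f s a + b s a) π') :
    value H s0 Q q π - value H s0 Q q π' ≤ ∑ s ∈ Finset.univ.erase sH, e s (π s) +
      ∑ s ∈ Finset.univ.erase sH, (2 * b s (π' s) + e s (π' s)) := by
  have hπ := value_le_value_add_sum (π := π) hP hl hQ hq (fun s => he s (π s))
    fun s => herr s (π s)
  have hπ' := value_add_le_value_add_sum (π := π') hP hl hQ hq (fun s => hb s (π' s))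
    (fun s => he s (π' s)) fun s => herr s (π' s)
  linarith

end Optimism

section EpisodeLaw

theorem exp_mul_one_sub_le_one (x : ℝ) : Real.exp x * (1 - x) ≤ 1 := by
  calc Real.exp x * (1 - x) ≤ Real.exp x * Real.exp (-x) :=
        mul_le_mul_of_nonneg_left (Real.one_sub_le_exp_neg x) (Real.exp_pos _).le
    _ = 1 := by rw [← Real.exp_add, add_neg_cancel, Real.exp_zero]

namespace CMDP

variable {C S A : Type*} [Fintype C] [Fintype S] {H : ℕ}

/-- Expectation of `g` over the contexts. -/
def ctxMean (M : CMDP C S A H) (g : C → ℝ) : ℝ := ∑ c, (M.ctx c).toReal * g c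

theorem ctxMean_const (M : CMDP C S A H) (b : ℝ) : M.ctxMean (fun _ => b) = b := by
  have hsum : ∑ c, M.ctx c = 1 := by rw [← tsum_fintype (L := .unconditional C), M.ctx.tsum_coe]
  rw [ctxMean, ← Finset.sum_mul, ← ENNReal.toReal_sum fun c _ => M.ctx.apply_ne_top c, hsum,
    ENNReal.toReal_one, one_mul]

theorem ctxMean_add (M : CMDP C S A H) (f g : C → ℝ) :
    M.ctxMean (fun c => f c + g c) = M.ctxMean f + M.ctxMean g := by
  simp only [ctxMean, mul_add, Finset.sum_add_distrib]

theorem ctxMean_const_mul (M : CMDP C S A H) (b : ℝ) (g : C → ℝ) :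
    M.ctxMean (fun c => b * g c) = b * M.ctxMean g := by
  simp only [ctxMean, mul_left_comm _ b, Finset.mul_sum]

theorem ctxMean_sum (M : CMDP C S A H) {ι : Type*} (I : Finset ι) (g : ι → C → ℝ) :
    M.ctxMean (fun c => ∑ i ∈ I, g i c) = ∑ i ∈ I, M.ctxMean (g i) := by
  simp only [ctxMean, Finset.mul_sum]
  exact Finset.sum_comm

theorem ctxMean_le_ctxMean (M : CMDP C S A H) {f g : C → ℝ} (h : ∀ c, f c ≤ g c) :
    M.ctxMean f ≤ M.ctxMean g :=
  Finset.sum_le_sum fun c _ => mul_le_mul_of_nonneg_left (h c) ENNReal.toReal_nonneg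

variable [DecidableEq S]

theorem ofReal_ctxMean_pathMean (M : CMDP C S A H) (π : C → S → A)
    {w : C → (Fin (H + 1) → S) → ℝ} (hw : ∀ c x, 0 ≤ w c x) :
    ENNReal.ofReal (M.ctxMean fun c => pathMean M.s0 (M.dyn c) (π c) (w c)) =
      ∑ c : C, ∑ x : Fin (H + 1) → S,
        (M.ctx c * ENNReal.ofReal (pathProb M.s0 (M.dyn c) (π c) x)) *
          ENNReal.ofReal (w c x) := by
  have hprob (c : C) (x : Fin (H + 1) → S) : 0 ≤ pathProb M.s0 (M.dyn c) (π c) x :=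
    pathProb_nonneg (M.isTransition c) _ _ _
  have hterm (c : C) (x : Fin (H + 1) → S) : 0 ≤ pathProb M.s0 (M.dyn c) (π c) x * w c x :=
    mul_nonneg (hprob c x) (hw c x)
  simp only [ctxMean, pathMean]
  rw [ENNReal.ofReal_sum_of_nonneg fun c _ =>
    mul_nonneg ENNReal.toReal_nonneg (Finset.sum_nonneg fun x _ => hterm c x)]
  refine Finset.sum_congr rfl fun c _ => ?_
  rw [ENNReal.ofReal_mul ENNReal.toReal_nonneg,
    ENNReal.ofReal_toReal (M.ctx.apply_ne_top c),
    ENNReal.ofReal_sum_of_nonneg fun x _ => hterm c x, Finset.mul_sum]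
  exact Finset.sum_congr rfl fun x _ => by rw [ENNReal.ofReal_mul (hprob c x), mul_assoc]

variable [MeasurableSpace C] [MeasurableSpace S] [MeasurableSpace A]

theorem lintegral_episodeLaw (M : CMDP C S A H) (π : C → S → A)
    {φ : Traj C S A H → ENNReal} (hφ : Measurable φ) :
    ∫⁻ τ, φ τ ∂(M.episodeLaw π) =
      ∑ c : C, ∑ x : Fin (H + 1) → S,
        (M.ctx c * ENNReal.ofReal (pathProb M.s0 (M.dyn c) (π c) x)) *
          ∫⁻ r, φ (c, x, (fun h => π c (x h.castSucc)), r)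
            ∂(Measure.pi fun h : Fin H => M.rew c (x h.castSucc) (π c (x h.castSucc))) := by
  rw [episodeLaw, lintegral_finsetSum_measure]
  refine Finset.sum_congr rfl fun c _ => ?_
  rw [lintegral_finsetSum_measure]
  refine Finset.sum_congr rfl fun x _ => ?_
  rw [lintegral_smul_measure, lintegral_map hφ (by fun_prop), smul_eq_mul]

instance (M : CMDP C S A H) (π : C → S → A) : IsProbabilityMeasure (M.episodeLaw π) := by
  have := fun c s a => M.isProb_rew c s a
  have hone := M.ofReal_ctxMean_pathMean π (w := fun _ _ => 1) fun _ _ => zero_le_one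
  simp only [pathMean_const (M.isTransition _), ctxMean_const, ENNReal.ofReal_one, mul_one] at hone
  constructor
  rw [← lintegral_one, M.lintegral_episodeLaw π measurable_const]
  simpa only [lintegral_const, measure_univ, mul_one] using hone.symm

theorem lintegral_exp_mean_sub_div_le_one (M : CMDP C S A H) (π : C → S → A)
    {Z : Traj C S A H → ℝ} (hZ : Measurable Z) {v : C → (Fin (H + 1) → S) → ℝ} {κ : ℝ}
    (hκ : 0 < κ) (hv : ∀ c x, v c x ≤ κ)
    (hexp : ∀ c x, ∫⁻ r, ENNReal.ofReal
        (Real.exp (-(Z (c, x, (fun h => π c (x h.castSucc)), r) / κ)))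
          ∂(Measure.pi fun h : Fin H => M.rew c (x h.castSucc) (π c (x h.castSucc))) ≤
        ENNReal.ofReal (1 - v c x / κ)) :
    ∫⁻ τ, ENNReal.ofReal (Real.exp
      (((M.ctxMean fun c => pathMean M.s0 (M.dyn c) (π c) (v c)) - Z τ) / κ))
        ∂(M.episodeLaw π) ≤ 1 := by
  set m := M.ctxMean fun c => pathMean M.s0 (M.dyn c) (π c) (v c)
  have hmean : (M.ctxMean fun c => pathMean M.s0 (M.dyn c) (π c) fun x => 1 - v c x / κ) =
      1 - m / κ := by
    have hlin (c : C) (x : Fin (H + 1) → S) : 1 - v c x / κ = 1 + -κ⁻¹ * v c x := by ring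
    simp only [hlin, pathMean_add, pathMean_const (M.isTransition _), pathMean_const_mul,
      ctxMean_add, ctxMean_const, ctxMean_const_mul]
    ring
  have hsplit (τ : Traj C S A H) : ENNReal.ofReal (Real.exp ((m - Z τ) / κ)) =
      ENNReal.ofReal (Real.exp (m / κ)) * ENNReal.ofReal (Real.exp (-(Z τ / κ))) := by
    rw [← ENNReal.ofReal_mul (Real.exp_pos _).le, ← Real.exp_add]
    ring_nf
  calc ∫⁻ τ, ENNReal.ofReal (Real.exp ((m - Z τ) / κ)) ∂(M.episodeLaw π)
      = ENNReal.ofReal (Real.exp (m / κ)) *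
          ∫⁻ τ, ENNReal.ofReal (Real.exp (-(Z τ / κ))) ∂(M.episodeLaw π) := by
        simp only [hsplit]
        exact lintegral_const_mul _ (by fun_prop)
    _ ≤ ENNReal.ofReal (Real.exp (m / κ)) * ENNReal.ofReal (1 - m / κ) := by
        rw [M.lintegral_episodeLaw π (by fun_prop), ← hmean, M.ofReal_ctxMean_pathMean π
          fun c x => sub_nonneg.2 ((div_le_one hκ).2 (hv c x))]
        gcongr
        exact hexp _ _
    _ ≤ 1 := by
        rw [← ENNReal.ofReal_mul (Real.exp_pos _).le, ← ENNReal.ofReal_one]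
        exact ENNReal.ofReal_le_ofReal (exp_mul_one_sub_le_one _)

end CMDP

end EpisodeLaw

section HistoryLaw

theorem measurable_snoc {E : Type*} [MeasurableSpace E] (n : ℕ) :
    Measurable fun p : (Fin n → E) × E =>
      (Fin.snoc (α := fun _ => E) p.1 p.2 : Fin (n + 1) → E) := by
  refine measurable_pi_lambda _ fun i => ?_
  induction i using Fin.lastCases with
  | last => simpa only [Fin.snoc_last] using measurable_snd
  | cast i =>
    simp only [Fin.snoc_castSucc]
    fun_prop

theorem measurable_take {E : Type*} [MeasurableSpace E] {m n : ℕ} (h : m ≤ n) :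
    Measurable fun σ : Fin n → E => (Fin.take m h σ : Fin m → E) :=
  measurable_pi_lambda _ fun _ => measurable_pi_apply _

theorem take_snoc {E : Type*} {m n : ℕ} (h : m ≤ n) (σ : Fin n → E) (τ : E) :
    Fin.take m (h.trans n.le_succ) (Fin.snoc (α := fun _ => E) σ τ : Fin (n + 1) → E) =
      Fin.take m h σ :=
  funext fun i => Fin.snoc_castSucc (α := fun _ => E) τ σ (Fin.castLE h i)

namespace Alg

variable {C S A : Type*} [Fintype S] [Fintype A] [DecidableEq A] {H : ℕ}

/-- The sum of `Y π τ` over the rounds of a history, where `π` is the policy of the round and `τ`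
its episode. -/
def total (𝒜 : Alg C S A H) (Y : (C → S → A) → Traj C S A H → ℝ) {n : ℕ}
    (σ : Fin n → Traj C S A H) : ℝ :=
  ∑ i : Fin n, Y (𝒜.policy (Fin.take i i.2.le σ)) (σ i)

theorem total_snoc (𝒜 : Alg C S A H) (Y : (C → S → A) → Traj C S A H → ℝ) {n : ℕ}
    (σ : Fin n → Traj C S A H) (τ : Traj C S A H) :
    𝒜.total Y (Fin.snoc (α := fun _ => Traj C S A H) σ τ : Fin (n + 1) → Traj C S A H) =
      𝒜.total Y σ + Y (𝒜.policy σ) τ := by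
  simp only [total, Fin.sum_univ_castSucc, Fin.snoc_castSucc, Fin.snoc_last, Fin.val_castSucc,
    Fin.val_last]
  congr 1
  · exact Finset.sum_congr rfl fun i _ => by rw [take_snoc i.2.le]
  · rw [take_snoc le_rfl, Fin.take_eq_self]

variable [MeasurableSpace C] [MeasurableSpace S] [MeasurableSpace A]

-- The oracles take values in finite classes, and the policy is a function of these values.
theorem measurable_policy [Finite C] [DecidableEq S] (𝒜 : Alg C S A H)
    {F : Finset (C → S → A → ℝ)} {Fp : Finset (C → S → A → S → ℝ)} (hF : IsRewOracle F 𝒜.rewOracle)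
    (hP : IsDynOracle Fp 𝒜.dynOracle) (n : ℕ) :
    Measurable fun σ : Fin n → Traj C S A H => 𝒜.policy σ := by
  have : MeasurableSingletonClass F := inferInstance
  have : MeasurableSingletonClass Fp := inferInstance
  have : MeasurableSingletonClass (F × Fp) := inferInstance
  let estimates : (Fin n → Traj C S A H) → Fin (n + 1) → F × Fp := fun σ i =>
    (⟨𝒜.rewOracle i (Fin.take i (Nat.le_of_lt_succ i.2) σ), ((hF i).2 _).1⟩,
      ⟨𝒜.dynOracle i (Fin.take i (Nat.le_of_lt_succ i.2) σ), ((hP i).2 _).1⟩)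
  let policyOf : (Fin (n + 1) → F × Fp) → C → S → A := fun φ c =>
    𝒜.policySeq
      (fun i => if hi : i ≤ n then (φ ⟨i, Nat.lt_succ_of_le hi⟩).1.1 else 0)
      (fun i => if hi : i ≤ n then (φ ⟨i, Nat.lt_succ_of_le hi⟩).2.1 else 0) c n
  have hestimates : Measurable estimates := measurable_pi_lambda _ fun i =>
    (((hF i).1.comp (measurable_take _)).subtype_mk).prodMk
      (((hP i).1.comp (measurable_take _)).subtype_mk)
  exact (measurable_of_finite policyOf).comp hestimates

variable [MeasurableSingletonClass A]

theorem measurable_total [Finite C] (𝒜 : Alg C S A H)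
    (hπ : ∀ n, Measurable fun σ : Fin n → Traj C S A H => 𝒜.policy σ)
    {Y : (C → S → A) → Traj C S A H → ℝ} (hY : ∀ π, Measurable (Y π)) (n : ℕ) :
    Measurable fun σ : Fin n → Traj C S A H => 𝒜.total Y σ := by
  have hY' : Measurable fun p : (C → S → A) × Traj C S A H => Y p.1 p.2 :=
    measurable_from_prod_countable_right hY
  exact Finset.measurable_sum _ fun i _ =>
    hY'.comp (((hπ i).comp (measurable_take i.2.le)).prodMk (measurable_pi_apply i))

variable [Fintype C] [DecidableEq S]

theorem lintegral_historyLaw_succ (𝒜 : Alg C S A H) (M : CMDP C S A H) {n : ℕ}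
    (hπ : Measurable fun σ : Fin n → Traj C S A H => 𝒜.policy σ)
    {φ : (Fin (n + 1) → Traj C S A H) → ENNReal} (hφ : Measurable φ) :
    ∫⁻ σ, φ σ ∂(𝒜.historyLaw M (n + 1)) =
      ∫⁻ σ, ∫⁻ τ, φ (Fin.snoc (α := fun _ => Traj C S A H) σ τ)
        ∂(M.episodeLaw (𝒜.policy σ)) ∂(𝒜.historyLaw M n) := by
  have hsnoc := measurable_snoc (E := Traj C S A H) n
  let κ : ProbabilityTheory.Kernel (Fin n → Traj C S A H) (Traj C S A H) :=
    ⟨fun σ => M.episodeLaw (𝒜.policy σ), (measurable_of_finite M.episodeLaw).comp hπ⟩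
  have : ProbabilityTheory.IsMarkovKernel κ :=
    ⟨fun σ => inferInstanceAs (IsProbabilityMeasure (M.episodeLaw (𝒜.policy σ)))⟩
  have hmap : Measurable fun σ : Fin n → Traj C S A H => (M.episodeLaw (𝒜.policy σ)).map
      fun τ => (Fin.snoc (α := fun _ => Traj C S A H) σ τ : Fin (n + 1) → Traj C S A H) := by
    refine Measure.measurable_of_measurable_coe _ fun s hs => ?_
    have hcoe (σ : Fin n → Traj C S A H) := Measure.map_apply (μ := κ σ)
      (hsnoc.comp (measurable_prodMk_left (x := σ))) hs
    exact (funext hcoe) ▸ ProbabilityTheory.Kernel.measurable_kernel_prodMk_left (hsnoc hs)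
  rw [historyLaw, Measure.lintegral_bind hmap.aemeasurable hφ.aemeasurable]
  exact lintegral_congr fun σ => lintegral_map hφ (hsnoc.comp measurable_prodMk_left)

theorem lintegral_take_historyLaw (𝒜 : Alg C S A H) (M : CMDP C S A H)
    (hπ : ∀ n, Measurable fun σ : Fin n → Traj C S A H => 𝒜.policy σ) {m n : ℕ} (h : m ≤ n)
    {φ : (Fin m → Traj C S A H) → ENNReal} (hφ : Measurable φ) :
    ∫⁻ σ, φ (Fin.take m h σ) ∂(𝒜.historyLaw M n) = ∫⁻ σ, φ σ ∂(𝒜.historyLaw M m) := by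
  induction n, h using Nat.le_induction with
  | base => rfl
  | succ n h ih =>
    rw [𝒜.lintegral_historyLaw_succ M (hπ n) (φ := fun σ => φ (Fin.take m _ σ))
      (hφ.comp (measurable_take _)), ← ih]
    simp only [take_snoc h, lintegral_const, measure_univ, mul_one]

theorem isProbabilityMeasure_historyLaw (𝒜 : Alg C S A H) (M : CMDP C S A H)
    (hπ : ∀ n, Measurable fun σ : Fin n → Traj C S A H => 𝒜.policy σ) (n : ℕ) :
    IsProbabilityMeasure (𝒜.historyLaw M n) := by
  have h := 𝒜.lintegral_take_historyLaw M hπ n.zero_le (φ := fun _ => 1) measurable_const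
  exact ⟨by simpa [historyLaw] using h⟩

theorem lintegral_exp_total_le_one (𝒜 : Alg C S A H) (M : CMDP C S A H)
    (hπ : ∀ n, Measurable fun σ : Fin n → Traj C S A H => 𝒜.policy σ)
    {Y : (C → S → A) → Traj C S A H → ℝ} (hY : ∀ π, Measurable (Y π))
    (hexp : ∀ π, ∫⁻ τ, ENNReal.ofReal (Real.exp (Y π τ)) ∂(M.episodeLaw π) ≤ 1) (n : ℕ) :
    ∫⁻ σ, ENNReal.ofReal (Real.exp (𝒜.total Y σ)) ∂(𝒜.historyLaw M n) ≤ 1 := by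
  have hmeas (n : ℕ) : Measurable fun σ : Fin n → Traj C S A H =>
      ENNReal.ofReal (Real.exp (𝒜.total Y σ)) := (𝒜.measurable_total hπ hY n).exp.ennreal_ofReal
  induction n with
  | zero => simp [historyLaw, total]
  | succ n ih =>
    rw [𝒜.lintegral_historyLaw_succ M (hπ n) (hmeas (n + 1))]
    refine (lintegral_mono fun σ => ?_).trans ih
    simp only [total_snoc, Real.exp_add, ENNReal.ofReal_mul (Real.exp_pos _).le]
    rw [lintegral_const_mul _ (hY _).exp.ennreal_ofReal]
    exact mul_le_of_le_one_right' (hexp _)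

end Alg

end HistoryLaw

section SquaredLoss

theorem exp_neg_le_of_abs_le_one {x : ℝ} (hx : |x| ≤ 1) : Real.exp (-x) ≤ 1 - x + x ^ 2 := by
  have := (abs_le.1 (Real.abs_exp_sub_one_sub_id_le (x := -x) (by rwa [abs_neg]))).2
  linarith [neg_sq x]

theorem exp_neg_sum_div_le {ι : Type*} [Fintype ι] {b κ : ℝ} {y d : ι → ℝ} (hb : 0 < b)
    (hκ : 0 < κ) (hbκ : 8 * b * Fintype.card ι ≤ κ) (hy : ∀ i, |y i| ≤ b)
    (hyd : ∀ i, y i ^ 2 ≤ 4 * b * d i) :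
    Real.exp (-((∑ i, y i) / κ)) ≤ 1 - (∑ i, y i - (∑ i, d i) / 2) / κ := by
  have hd : 0 ≤ ∑ i, d i := Finset.sum_nonneg fun i _ =>
    nonneg_of_mul_nonneg_right ((sq_nonneg _).trans (hyd i)) (by positivity)
  have habs : |∑ i, y i| ≤ Fintype.card ι * b := by
    refine (Finset.abs_sum_le_sum_abs _ _).trans ((Finset.sum_le_sum fun i _ => hy i).trans_eq ?_)
    rw [Finset.sum_const, Finset.card_univ, nsmul_eq_mul]
  have hone : |(∑ i, y i) / κ| ≤ 1 := by
    rw [abs_div, abs_of_pos hκ, div_le_one hκ]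
    linarith [mul_nonneg (Fintype.card ι).cast_nonneg hb.le]
  have hsq : (∑ i, y i) ^ 2 ≤ κ / 2 * ∑ i, d i := by
    calc (∑ i, y i) ^ 2 ≤ Fintype.card ι * ∑ i, y i ^ 2 := sq_sum_le_card_mul_sum_sq
      _ ≤ Fintype.card ι * ∑ i, 4 * b * d i :=
          mul_le_mul_of_nonneg_left (Finset.sum_le_sum fun i _ => hyd i) (Nat.cast_nonneg _)
      _ = 8 * b * Fintype.card ι / 2 * ∑ i, d i := by rw [← Finset.mul_sum]; ring
      _ ≤ κ / 2 * ∑ i, d i := by gcongr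
  have hsq' : ((∑ i, y i) / κ) ^ 2 ≤ (∑ i, d i) / 2 / κ := by
    rw [div_pow, sq κ, ← div_div]
    refine div_le_div_of_nonneg_right ((div_le_iff₀ hκ).2 ?_) hκ.le
    linarith
  linarith [exp_neg_le_of_abs_le_one hone, sub_div (∑ i, y i) ((∑ i, d i) / 2) κ]

theorem lintegral_exp_neg_sum_div_le {ι Ω : Type*} [Fintype ι] [MeasurableSpace Ω]
    (μ : Measure Ω) [IsProbabilityMeasure μ] {b κ : ℝ} {Y : ι → Ω → ℝ} {d : ι → ℝ} (hb : 0 < b)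
    (hκ : 0 < κ) (hbκ : 8 * b * Fintype.card ι ≤ κ) (hmeas : ∀ i, Measurable (Y i))
    (hY : ∀ᵐ ω ∂μ, ∀ i, |Y i ω| ≤ b) (hYd : ∀ᵐ ω ∂μ, ∀ i, Y i ω ^ 2 ≤ 4 * b * d i)
    (hmean : ∀ i, ∫ ω, Y i ω ∂μ = d i) :
    ∫⁻ ω, ENNReal.ofReal (Real.exp (-((∑ i, Y i ω) / κ))) ∂μ ≤
      ENNReal.ofReal (1 - (∑ i, d i) / 2 / κ) := by
  have hint (i : ι) : Integrable (Y i) μ :=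
    Integrable.of_bound (hmeas i).aestronglyMeasurable b (hY.mono fun ω h => h i)
  have hsum : Integrable (fun ω => (∑ i, Y i ω - (∑ i, d i) / 2) / κ) μ :=
    ((integrable_finsetSum _ fun i _ => hint i).sub (integrable_const _)).div_const _
  have hle : ∀ᵐ ω ∂μ, Real.exp (-((∑ i, Y i ω) / κ)) ≤
      1 - (∑ i, Y i ω - (∑ i, d i) / 2) / κ := by
    filter_upwards [hY, hYd] with ω h h' using exp_neg_sum_div_le hb hκ hbκ h h'
  have hval : ∫ ω, (1 - (∑ i, Y i ω - (∑ i, d i) / 2) / κ) ∂μ = 1 - (∑ i, d i) / 2 / κ := by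
    rw [integral_sub (integrable_const _) hsum, integral_div,
      integral_sub (integrable_finsetSum _ fun i _ => hint i) (integrable_const _),
      integral_finsetSum _ fun i _ => hint i]
    simp only [hmean, integral_const, probReal_univ, one_smul]
    ring
  have hbound : Integrable (fun ω => 1 - (∑ i, Y i ω - (∑ i, d i) / 2) / κ) μ :=
    (integrable_const _).sub hsum
  rw [← hval, ofReal_integral_eq_lintegral_ofReal hbound
    (hle.mono fun ω h => (Real.exp_pos _).le.trans h)]
  exact lintegral_mono_ae (hle.mono fun ω h => ENNReal.ofReal_le_ofReal h)

theorem abs_sq_sub_sub_sq_sub_le_one {u v r : ℝ} (hu : u ∈ Set.Icc 0 1) (hv : v ∈ Set.Icc 0 1)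
    (hr : r ∈ Set.Icc 0 1) : |(u - r) ^ 2 - (v - r) ^ 2| ≤ 1 := by
  have hsq {w : ℝ} (hw : w ∈ Set.Icc 0 1) : (w - r) ^ 2 ∈ Set.Icc 0 1 :=
    ⟨sq_nonneg _, by nlinarith [hw.1, hw.2, hr.1, hr.2]⟩
  exact abs_sub_le_iff.2 ⟨by linarith [(hsq hu).2, (hsq hv).1],
    by linarith [(hsq hu).1, (hsq hv).2]⟩

theorem sq_sq_sub_sub_sq_sub_le {u v r : ℝ} (hu : u ∈ Set.Icc 0 1) (hv : v ∈ Set.Icc 0 1)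
    (hr : r ∈ Set.Icc 0 1) : ((u - r) ^ 2 - (v - r) ^ 2) ^ 2 ≤ 4 * (u - v) ^ 2 := by
  have hsum : (u + v - 2 * r) ^ 2 ≤ 2 ^ 2 :=
    sq_le_sq' (by linarith [hu.1, hv.1, hr.2]) (by linarith [hu.2, hv.2, hr.1])
  nlinarith [mul_le_mul_of_nonneg_right hsum (sq_nonneg (u - v))]

theorem integrable_id_of_ae_mem_Icc {ν : Measure ℝ} [IsFiniteMeasure ν]
    (hν : ∀ᵐ r ∂ν, r ∈ Set.Icc (0 : ℝ) 1) : Integrable (fun r => r) ν :=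
  Integrable.of_bound measurable_id.aestronglyMeasurable 1
    (hν.mono fun r hr => by rw [Real.norm_eq_abs, abs_of_nonneg hr.1]; exact hr.2)

theorem integral_mem_Icc_of_ae_mem_Icc {ν : Measure ℝ} [IsProbabilityMeasure ν]
    (hν : ∀ᵐ r ∂ν, r ∈ Set.Icc (0 : ℝ) 1) : ∫ r, r ∂ν ∈ Set.Icc (0 : ℝ) 1 :=
  (convex_Icc 0 1).integral_mem isClosed_Icc hν (integrable_id_of_ae_mem_Icc hν)

theorem integral_sq_sub_sub_sq_sub_integral {ν : Measure ℝ} [IsProbabilityMeasure ν]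
    (hν : Integrable (fun r => r) ν) (u : ℝ) :
    ∫ r, ((u - r) ^ 2 - (∫ x, x ∂ν - r) ^ 2) ∂ν = (u - ∫ x, x ∂ν) ^ 2 := by
  set v := ∫ x, x ∂ν with hv
  have hlin (r : ℝ) : (u - r) ^ 2 - (v - r) ^ 2 = u ^ 2 - v ^ 2 - 2 * (u - v) * r := by ring
  simp only [hlin]
  rw [integral_sub (integrable_const _) (hν.const_mul _), integral_const_mul, integral_const,
    probReal_univ, one_smul, ← hv]
  ring

theorem lintegral_exp_neg_sum_sq_sub_le {ι : Type*} [Fintype ι] (μ : ι → Measure ℝ)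
    [∀ i, IsProbabilityMeasure (μ i)] (hμ : ∀ i, ∀ᵐ r ∂(μ i), r ∈ Set.Icc (0 : ℝ) 1)
    {u : ι → ℝ} (hu : ∀ i, u i ∈ Set.Icc 0 1) {κ : ℝ} (hκ : 0 < κ) (hικ : 8 * Fintype.card ι ≤ κ) :
    ∫⁻ r, ENNReal.ofReal
        (Real.exp (-((∑ i, ((u i - r i) ^ 2 - (∫ x, x ∂(μ i) - r i) ^ 2)) / κ)))
        ∂(Measure.pi μ) ≤
      ENNReal.ofReal (1 - (∑ i, (u i - ∫ x, x ∂(μ i)) ^ 2) / 2 / κ) := by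
  have hmem : ∀ᵐ r ∂(Measure.pi μ), ∀ i, r i ∈ Set.Icc (0 : ℝ) 1 :=
    ae_all_iff.2 fun i => (Measure.quasiMeasurePreserving_eval μ i).ae (hμ i)
  have hmean (i : ι) := integral_mem_Icc_of_ae_mem_Icc (hμ i)
  refine lintegral_exp_neg_sum_div_le (b := 1) _ one_pos hκ (by linarith)
    (fun i => by fun_prop) ?_ ?_ fun i => ?_
  · filter_upwards [hmem] with r hr i using abs_sq_sub_sub_sq_sub_le_one (hu i) (hmean i) (hr i)
  · filter_upwards [hmem] with r hr i
    simpa only [mul_one] using sq_sq_sub_sub_sq_sub_le (hu i) (hmean i) (hr i)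
  · rw [integral_comp_eval (μ := μ) (i := i)
      (f := fun x => (u i - x) ^ 2 - (∫ x, x ∂(μ i) - x) ^ 2) (by fun_prop)]
    exact integral_sq_sub_sub_sq_sub_integral (integrable_id_of_ae_mem_Icc (hμ i)) (u i)

variable {S : Type*} [Fintype S] [DecidableEq S]

/-- Brier score of the forecast `p` when the outcome is `t`: the squared loss in which the dynamics
are fitted. -/
def brierScore (p : S → ℝ) (t : S) : ℝ := ∑ s, (p s - if s = t then 1 else 0) ^ 2

theorem brierScore_nonneg (p : S → ℝ) (t : S) : 0 ≤ brierScore p t :=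
  Finset.sum_nonneg fun _ _ => sq_nonneg _

variable {p q : S → ℝ}

theorem brierScore_le_two (hp : p ∈ stdSimplex ℝ S) (t : S) : brierScore p t ≤ 2 := by
  have hle (s : S) : p s ≤ 1 :=
    hp.2 ▸ Finset.single_le_sum (fun i _ => hp.1 i) (Finset.mem_univ s)
  calc ∑ s, (p s - if s = t then 1 else 0) ^ 2 ≤ ∑ s, (p s + if s = t then 1 else 0) := by
        refine Finset.sum_le_sum fun s _ => ?_
        split_ifs <;> nlinarith [hp.1 s, hle s]
    _ = 2 := by
        rw [Finset.sum_add_distrib, hp.2, Finset.sum_ite_eq' Finset.univ t,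
          if_pos (Finset.mem_univ t), one_add_one_eq_two]

theorem abs_brierScore_sub_le_two (hp : p ∈ stdSimplex ℝ S) (hq : q ∈ stdSimplex ℝ S) (t : S) :
    |brierScore p t - brierScore q t| ≤ 2 :=
  abs_sub_le_iff.2 ⟨by linarith [brierScore_le_two hp t, brierScore_nonneg q t],
    by linarith [brierScore_le_two hq t, brierScore_nonneg p t]⟩

theorem sq_brierScore_sub_le (hp : p ∈ stdSimplex ℝ S) (hq : q ∈ stdSimplex ℝ S) (t : S) :
    (brierScore p t - brierScore q t) ^ 2 ≤ 8 * ∑ s, (p s - q s) ^ 2 := by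
  let e (s : S) : ℝ := if s = t then 1 else 0
  have hfactor : brierScore p t - brierScore q t = ∑ s, (p s - q s) * (p s + q s - 2 * e s) := by
    rw [brierScore, brierScore, ← Finset.sum_sub_distrib]
    exact Finset.sum_congr rfl fun s _ => by ring
  have hsum : ∑ s, (p s + q s - 2 * e s) ^ 2 ≤ 8 := by
    calc ∑ s, (p s + q s - 2 * e s) ^ 2
        ≤ ∑ s, (2 * (p s - e s) ^ 2 + 2 * (q s - e s) ^ 2) :=
          Finset.sum_le_sum fun s _ => by nlinarith [sq_nonneg (p s - q s)]
      _ = 2 * brierScore p t + 2 * brierScore q t := by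
          rw [Finset.sum_add_distrib, ← Finset.mul_sum, ← Finset.mul_sum, brierScore, brierScore]
      _ ≤ 8 := by linarith [brierScore_le_two hp t, brierScore_le_two hq t]
  rw [hfactor, mul_comm]
  exact (Finset.sum_mul_sq_le_sq_mul_sq _ _ _).trans
    (mul_le_mul_of_nonneg_left hsum (Finset.sum_nonneg fun s _ => sq_nonneg _))

theorem sum_mul_brierScore_sub (p : S → ℝ) (hq : ∑ s, q s = 1) :
    ∑ t, q t * (brierScore p t - brierScore q t) = ∑ s, (p s - q s) ^ 2 := by
  have hscore (w : S → ℝ) (t : S) : brierScore w t = ∑ s, w s ^ 2 - 2 * w t + 1 := by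
    have hsq (s : S) : (w s - if s = t then 1 else 0) ^ 2 =
        w s ^ 2 - (if s = t then 2 * w s else 0) + if s = t then 1 else 0 := by
      split_ifs <;> ring
    simp only [brierScore, hsq, Finset.sum_add_distrib, Finset.sum_sub_distrib,
      Finset.sum_ite_eq', Finset.mem_univ, if_true]
  calc ∑ t, q t * (brierScore p t - brierScore q t)
      = ∑ t, (q t * (∑ s, p s ^ 2 - ∑ s, q s ^ 2) + 2 * q t ^ 2 - 2 * (p t * q t)) :=
        Finset.sum_congr rfl fun t _ => by rw [hscore, hscore]; ring
    _ = ∑ t, p t ^ 2 + ∑ t, q t ^ 2 - 2 * ∑ t, p t * q t := by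
        rw [Finset.sum_sub_distrib, Finset.sum_add_distrib, ← Finset.sum_mul, hq, ← Finset.mul_sum,
          ← Finset.mul_sum]
        ring
    _ = ∑ s, (p s - q s) ^ 2 := by
        rw [Finset.mul_sum, ← Finset.sum_add_distrib, ← Finset.sum_sub_distrib]
        exact Finset.sum_congr rfl fun s _ => by ring

end SquaredLoss

theorem IsTransition.mem_stdSimplex {S A : Type*} [Fintype S] {P : S → A → S → ℝ}
    (hP : IsTransition P) (s : S) (a : A) : P s a ∈ stdSimplex ℝ S :=
  ⟨hP.1 s a, hP.2 s a⟩

namespace CMDP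

section Regression

variable {C S A : Type*} [Fintype S] {H : ℕ} (M : CMDP C S A H)

theorem meanRew_mem_Icc (c : C) (s : S) (a : A) : M.meanRew c s a ∈ Set.Icc 0 1 :=
  have := M.isProb_rew c s a
  integral_mem_Icc_of_ae_mem_Icc (M.rew_mem c s a)

/-- Excess over the true rewards of the squared loss of the reward function `f` on an episode. -/
def rewGap (f : C → S → A → ℝ) (τ : Traj C S A H) : ℝ :=
  ∑ h : Fin H, ((f τ.1 (τ.2.1 h.castSucc) (τ.2.2.1 h) - τ.2.2.2 h) ^ 2 -
    (M.meanRew τ.1 (τ.2.1 h.castSucc) (τ.2.2.1 h) - τ.2.2.2 h) ^ 2)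

theorem sum_rewGap (f : C → S → A → ℝ) {n : ℕ} (σ : Fin n → Traj C S A H) :
    ∑ i, M.rewGap f (σ i) = rewLoss f σ - rewLoss M.meanRew σ := by
  simp only [rewLoss, rewGap, Finset.sum_sub_distrib]

variable [DecidableEq S]

/-- Excess over the true dynamics of the squared loss of the dynamics `P` on an episode. -/
def dynGap (P : C → S → A → S → ℝ) (τ : Traj C S A H) : ℝ :=
  ∑ h : Fin H, (brierScore (P τ.1 (τ.2.1 h.castSucc) (τ.2.2.1 h)) (τ.2.1 h.succ) -
    brierScore (M.dyn τ.1 (τ.2.1 h.castSucc) (τ.2.2.1 h)) (τ.2.1 h.succ))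

theorem sum_dynGap (P : C → S → A → S → ℝ) {n : ℕ} (σ : Fin n → Traj C S A H) :
    ∑ i, M.dynGap P (σ i) = dynLoss P σ - dynLoss M.dyn σ := by
  simp only [dynLoss, dynGap, brierScore, Finset.sum_sub_distrib]

/-- Expected squared error, in the context `c`, of the reward function `f` along an episode. -/
def rewDevAt (f : C → S → A → ℝ) (c : C) (π : S → A) : ℝ :=
  value H M.s0 (M.dyn c) (fun s a => (f c s a - M.meanRew c s a) ^ 2) π

/-- Expected squared error, in the context `c`, of the dynamics `P` along an episode. -/
def dynDevAt (P : C → S → A → S → ℝ) (c : C) (π : S → A) : ℝ :=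
  value H M.s0 (M.dyn c) (fun s a => ∑ s', (P c s a s' - M.dyn c s a s') ^ 2) π

theorem val_sub_val_le (c : C) (π π' : S → A) : M.val c π - M.val c π' ≤ H := by
  have hle := value_le (M.isTransition c) H M.s0 (fun s a => (M.meanRew_mem_Icc c s a).2) π
  have hnonneg :=
    value_nonneg (M.isTransition c) H M.s0 (fun s a => (M.meanRew_mem_Icc c s a).1) π'
  rw [val, val]
  linarith

theorem pathMean_sum_brierScore_sub (P : C → S → A → S → ℝ) (c : C) (π : S → A) :
    (pathMean M.s0 (M.dyn c) π fun x => ∑ h : Fin H,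
      (brierScore (P c (x h.castSucc) (π (x h.castSucc))) (x h.succ) -
        brierScore (M.dyn c (x h.castSucc) (π (x h.castSucc))) (x h.succ))) = M.dynDevAt P c π := by
  rw [pathMean_sum_transition (M.isTransition c) M.s0 π fun s t =>
    brierScore (P c s (π s)) t - brierScore (M.dyn c s (π s)) t]
  simp only [dynDevAt, value, sum_mul_brierScore_sub _ ((M.isTransition c).2 _ _)]

theorem pathMean_sum_brierScore_sub_sub_half (P : C → S → A → S → ℝ) (c : C) (π : S → A) :
    (pathMean M.s0 (M.dyn c) π fun x =>
      ∑ h : Fin H, (brierScore (P c (x h.castSucc) (π (x h.castSucc))) (x h.succ) -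
        brierScore (M.dyn c (x h.castSucc) (π (x h.castSucc))) (x h.succ)) -
      (∑ h : Fin H, ∑ s', (P c (x h.castSucc) (π (x h.castSucc)) s' -
        M.dyn c (x h.castSucc) (π (x h.castSucc)) s') ^ 2) / 2) = M.dynDevAt P c π / 2 := by
  have hdev : (pathMean M.s0 (M.dyn c) π fun x => ∑ h : Fin H, ∑ s',
      (P c (x h.castSucc) (π (x h.castSucc)) s' -
        M.dyn c (x h.castSucc) (π (x h.castSucc)) s') ^ 2) = M.dynDevAt P c π := rfl
  simp only [sub_eq_add_neg (∑ _ : Fin H, _), div_eq_inv_mul _ (2 : ℝ), ← neg_mul]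
  rw [pathMean_add, pathMean_const_mul, hdev, pathMean_sum_brierScore_sub]
  ring

variable [Fintype C]

/-- Expected squared error of the reward function `f` along an episode of `π`. -/
def rewDev (f : C → S → A → ℝ) (π : C → S → A) : ℝ := M.ctxMean fun c => M.rewDevAt f c (π c)

/-- Expected squared error of the dynamics `P` along an episode of `π`. -/
def dynDev (P : C → S → A → S → ℝ) (π : C → S → A) : ℝ := M.ctxMean fun c => M.dynDevAt P c (π c)

/-- Expected regret of `π` in one episode, relative to `πs`. -/
def meanRegret (πs π : C → S → A) : ℝ := M.ctxMean fun c => M.val c (πs c) - M.val c (π c)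

end Regression

section ExponentialMoments

variable {C S A : Type*} [Fintype S] [MeasurableSpace C] [MeasurableSpace S] [MeasurableSpace A]
  [MeasurableSingletonClass C] {H : ℕ} (M : CMDP C S A H)

theorem measurable_rewGap [Finite C] [Finite A] [MeasurableSingletonClass S]
    [MeasurableSingletonClass A] (f : C → S → A → ℝ) : Measurable (M.rewGap f) := by
  have hcoord (g : C → S → A → ℝ) (h : Fin H) : Measurable fun τ : Traj C S A H =>
      g τ.1 (τ.2.1 h.castSucc) (τ.2.2.1 h) :=
    (measurable_of_finite fun p : C × S × A => g p.1 p.2.1 p.2.2).comp (by fun_prop :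
      Measurable fun τ : Traj C S A H => (τ.1, τ.2.1 h.castSucc, τ.2.2.1 h))
  have hrew (h : Fin H) : Measurable fun τ : Traj C S A H => τ.2.2.2 h := by fun_prop
  exact Finset.measurable_fun_sum _ fun h _ => (((hcoord f h).sub (hrew h)).pow_const 2).sub
    (((hcoord M.meanRew h).sub (hrew h)).pow_const 2)

theorem measurable_dynGap [DecidableEq S] [Finite C] [Finite A] [MeasurableSingletonClass S]
    [MeasurableSingletonClass A] (P : C → S → A → S → ℝ) : Measurable (M.dynGap P) := by
  let score (Q : C → S → A → S → ℝ) (p : C × S × A × S) : ℝ :=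
    brierScore (Q p.1 p.2.1 p.2.2.1) p.2.2.2
  have hscore (Q : C → S → A → S → ℝ) : Measurable (score Q) := measurable_of_finite _
  let step (h : Fin H) (τ : Traj C S A H) : C × S × A × S :=
    (τ.1, τ.2.1 h.castSucc, τ.2.2.1 h, τ.2.1 h.succ)
  have hstep (h : Fin H) : Measurable (step h) := by fun_prop
  have hsum : Measurable fun τ => ∑ h, (score P (step h τ) - score M.dyn (step h τ)) :=
    Finset.measurable_fun_sum _ fun h _ =>
      ((hscore P).comp (hstep h)).sub ((hscore M.dyn).comp (hstep h))
  exact hsum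

variable [Fintype C] [DecidableEq S]

theorem lintegral_exp_regret_sub_meanRegret_le_one (hH : 0 < H) {πs : C → S → A}
    (hπs : M.IsOptimal πs) (π : C → S → A) :
    ∫⁻ τ, ENNReal.ofReal (Real.exp
      ((M.val τ.1 (πs τ.1) - M.val τ.1 (π τ.1) - 2 * M.meanRegret πs π) / H))
        ∂(M.episodeLaw π) ≤ 1 := by
  have hH' : (0 : ℝ) < H := Nat.cast_pos.2 hH
  have := fun c s a => M.isProb_rew c s a
  let R (c : C) : ℝ := M.val c (πs c) - M.val c (π c)
  have hR (c : C) : R c / H ∈ Set.Icc 0 1 :=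
    ⟨div_nonneg (sub_nonneg.2 (hπs c _)) hH'.le, (div_le_one hH').2 (M.val_sub_val_le c _ _)⟩
  have hexp (c : C) : Real.exp (-(-R c / H)) ≤ 1 - -2 * R c / H := by
    have hbound := exp_neg_le_of_abs_le_one (x := -(R c / H))
      (by rw [abs_neg, abs_of_nonneg (hR c).1]; exact (hR c).2)
    rw [neg_div, mul_div_assoc]
    nlinarith [(hR c).1, (hR c).2]
  have hmoment := M.lintegral_exp_mean_sub_div_le_one π (Z := fun τ => -R τ.1)
    ((measurable_of_finite fun c => -R c).comp measurable_fst) (v := fun c _ => -2 * R c) hH'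
    (fun c _ => by linarith [sub_nonneg.2 (hπs c (π c))]) fun c x => by
      simpa only [lintegral_const, measure_univ, mul_one] using
        ENNReal.ofReal_le_ofReal (hexp c)
  simp only [pathMean_const (M.isTransition _), ctxMean_const_mul, sub_neg_eq_add] at hmoment
  convert hmoment using 6 with τ
  rw [meanRegret]
  ring

variable [Finite A] [MeasurableSingletonClass S] [MeasurableSingletonClass A]

theorem lintegral_exp_rewDev_sub_rewGap_le_one (hH : 0 < H) {f : C → S → A → ℝ}
    (hf : ∀ c s a, f c s a ∈ Set.Icc 0 1) (π : C → S → A) :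
    ∫⁻ τ, ENNReal.ofReal (Real.exp ((M.rewDev f π / 2 - M.rewGap f τ) / (8 * H)))
      ∂(M.episodeLaw π) ≤ 1 := by
  have hH' : (0 : ℝ) < H := Nat.cast_pos.2 hH
  have := fun c s a => M.isProb_rew c s a
  let d (c : C) (x : Fin (H + 1) → S) : ℝ := ∑ h : Fin H,
    (f c (x h.castSucc) (π c (x h.castSucc)) - M.meanRew c (x h.castSucc) (π c (x h.castSucc))) ^ 2
  have hd (c : C) (x : Fin (H + 1) → S) : d c x ≤ H := by
    refine (Finset.sum_le_sum (g := fun _ => 1) fun h _ => ?_).trans (by simp)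
    exact (sq_le_one_iff_abs_le_one _).2 (abs_sub_le_of_nonneg_of_le (hf _ _ _).1 (hf _ _ _).2
      (M.meanRew_mem_Icc _ _ _).1 (M.meanRew_mem_Icc _ _ _).2)
  have hmean : M.rewDev f π / 2 =
      M.ctxMean fun c => pathMean M.s0 (M.dyn c) (π c) fun x => d c x / 2 := by
    simp only [div_eq_inv_mul _ (2 : ℝ), pathMean_const_mul, ctxMean_const_mul]
    rfl
  rw [hmean]
  exact M.lintegral_exp_mean_sub_div_le_one π (M.measurable_rewGap f) (by positivity)
    (fun c x => by linarith [hd c x]) fun c x =>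
      lintegral_exp_neg_sum_sq_sub_le _ (fun h => M.rew_mem _ _ _) (fun h => hf _ _ _)
        (by positivity) (by rw [Fintype.card_fin])

theorem lintegral_exp_dynDev_sub_dynGap_le_one (hH : 0 < H) {P : C → S → A → S → ℝ}
    (hP : ∀ c, IsTransition (P c)) (π : C → S → A) :
    ∫⁻ τ, ENNReal.ofReal (Real.exp ((M.dynDev P π / 2 - M.dynGap P τ) / (16 * H)))
      ∂(M.episodeLaw π) ≤ 1 := by
  have hH' : (0 : ℝ) < H := Nat.cast_pos.2 hH
  have := fun c s a => M.isProb_rew c s a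
  let y (c : C) (s t : S) : ℝ := brierScore (P c s (π c s)) t - brierScore (M.dyn c s (π c s)) t
  let d (c : C) (s : S) : ℝ := ∑ s', (P c s (π c s) s' - M.dyn c s (π c s) s') ^ 2
  have hd (c : C) (s : S) : 0 ≤ d c s := Finset.sum_nonneg fun _ _ => sq_nonneg _
  have hy (c : C) (s t : S) : |y c s t| ≤ 2 :=
    abs_brierScore_sub_le_two ((hP c).mem_stdSimplex _ _) ((M.isTransition c).mem_stdSimplex _ _) t
  have hyd (c : C) (s t : S) : y c s t ^ 2 ≤ 4 * 2 * d c s :=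
    (sq_brierScore_sub_le ((hP c).mem_stdSimplex _ _) ((M.isTransition c).mem_stdSimplex _ _)
      t).trans_eq (by ring)
  let v (c : C) (x : Fin (H + 1) → S) : ℝ :=
    ∑ h : Fin H, y c (x h.castSucc) (x h.succ) - (∑ h : Fin H, d c (x h.castSucc)) / 2
  have hv (c : C) (x : Fin (H + 1) → S) : v c x ≤ 16 * H := by
    have hsum : ∑ h : Fin H, y c (x h.castSucc) (x h.succ) ≤ H * 2 :=
      (Finset.sum_le_sum fun h _ => (le_abs_self _).trans (hy _ _ _)).trans_eq (by simp)
    have hsum' : 0 ≤ ∑ h : Fin H, d c (x h.castSucc) := Finset.sum_nonneg fun h _ => hd _ _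
    simp only [v]
    linarith
  have hmean : M.dynDev P π / 2 = M.ctxMean fun c => pathMean M.s0 (M.dyn c) (π c) (v c) := by
    simp only [v, y, d, pathMean_sum_brierScore_sub_sub_half]
    simp only [dynDev, div_eq_inv_mul, ctxMean_const_mul]
  rw [hmean]
  refine M.lintegral_exp_mean_sub_div_le_one π (M.measurable_dynGap P) (by positivity) hv
    fun c x => ?_
  refine (lintegral_const (ENNReal.ofReal (Real.exp (-((∑ h : Fin H,
    y c (x h.castSucc) (x h.succ)) / (16 * H)))))).trans_le ?_
  rw [measure_univ, mul_one]
  exact ENNReal.ofReal_le_ofReal (exp_neg_sum_div_le two_pos (by positivity)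
    (by rw [Fintype.card_fin]; exact (by ring : 8 * 2 * (H : ℝ) = 16 * H).le)
    (fun h => hy _ _ _) fun h => hyd _ _ _)

end ExponentialMoments

end CMDP

section Concentration

theorem measure_log_lt_le {Ω : Type*} [MeasurableSpace Ω] (μ : Measure Ω) {X : Ω → ℝ}
    (hX : Measurable X) (hexp : ∫⁻ ω, ENNReal.ofReal (Real.exp (X ω)) ∂μ ≤ 1) {δ : ℝ}
    (hδ : 0 < δ) : μ {ω | Real.log (1 / δ) < X ω} ≤ ENNReal.ofReal δ := by
  have hmarkov : ENNReal.ofReal (1 / δ) *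
      μ {ω | ENNReal.ofReal (1 / δ) ≤ ENNReal.ofReal (Real.exp (X ω))} ≤ 1 :=
    (mul_meas_ge_le_lintegral hX.exp.ennreal_ofReal _).trans hexp
  have hsubset : {ω | Real.log (1 / δ) < X ω} ⊆
      {ω | ENNReal.ofReal (1 / δ) ≤ ENNReal.ofReal (Real.exp (X ω))} := fun ω hω =>
    ENNReal.ofReal_le_ofReal ((Real.log_lt_iff_lt_exp (by positivity)).1 hω).le
  calc μ {ω | Real.log (1 / δ) < X ω}
      = ENNReal.ofReal δ * (ENNReal.ofReal (1 / δ) * μ {ω | Real.log (1 / δ) < X ω}) := by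
        rw [← mul_assoc, ← ENNReal.ofReal_mul hδ.le, mul_one_div_cancel hδ.ne',
          ENNReal.ofReal_one, one_mul]
    _ ≤ ENNReal.ofReal δ * 1 := by
        gcongr
        exact (mul_le_mul_right (measure_mono hsubset) _).trans hmarkov
    _ = ENNReal.ofReal δ := mul_one _

theorem ofReal_one_sub_le_measure {Ω : Type*} [MeasurableSpace Ω] (μ : Measure Ω)
    [IsProbabilityMeasure μ] {s : Set Ω} {δ : ℝ} (hδ : 0 ≤ δ) (h : μ sᶜ ≤ ENNReal.ofReal δ) :
    ENNReal.ofReal (1 - δ) ≤ μ s := by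
  rw [ENNReal.ofReal_sub 1 hδ, ENNReal.ofReal_one, tsub_le_iff_right]
  calc (1 : ENNReal) = μ (s ∪ sᶜ) := by rw [Set.union_compl_self, measure_univ]
    _ ≤ μ s + μ sᶜ := measure_union_le _ _
    _ ≤ μ s + ENNReal.ofReal δ := by gcongr

namespace Alg

variable {C S A : Type*} [Fintype C] [Fintype S] [Fintype A] [DecidableEq S] [DecidableEq A]
  [MeasurableSpace C] [MeasurableSpace S] [MeasurableSpace A] [MeasurableSingletonClass A] {H : ℕ}
  (𝒜 : Alg C S A H) (M : CMDP C S A H)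

theorem historyLaw_exists_log_lt_total_take_le
    (hπ : ∀ n, Measurable fun σ : Fin n → Traj C S A H => 𝒜.policy σ) {ι : Type*} {J : Finset ι}
    {Y : ι → (C → S → A) → Traj C S A H → ℝ} (hY : ∀ j ∈ J, ∀ π, Measurable (Y j π))
    (hexp : ∀ j ∈ J, ∀ π, ∫⁻ τ, ENNReal.ofReal (Real.exp (Y j π τ)) ∂(M.episodeLaw π) ≤ 1)
    {δ : ℝ} (hδ : 0 < δ) (n : ℕ) :
    𝒜.historyLaw M n {σ | ∃ t : Fin n, ∃ j ∈ J,
      Real.log (n * J.card / δ) < 𝒜.total (Y j) (Fin.take t t.2.le σ)} ≤ ENNReal.ofReal δ := by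
  have hunion : {σ : Fin n → Traj C S A H | ∃ t : Fin n, ∃ j ∈ J,
      Real.log (n * J.card / δ) < 𝒜.total (Y j) (Fin.take t t.2.le σ)} =
      ⋃ t : Fin n, ⋃ j ∈ J,
        {σ | Real.log (1 / (δ / (n * J.card))) < 𝒜.total (Y j) (Fin.take t t.2.le σ)} := by
    ext σ
    simp only [one_div_div, Set.mem_iUnion, Set.mem_ofPred_eq, exists_prop]
  have htail (t : Fin n) (j : ι) (hj : j ∈ J) : 𝒜.historyLaw M n
      {σ | Real.log (1 / (δ / (n * J.card))) < 𝒜.total (Y j) (Fin.take t t.2.le σ)} ≤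
        ENNReal.ofReal (δ / (n * J.card)) := by
    have hn : (0 : ℝ) < n := Nat.cast_pos.2 t.pos
    have hJ : (0 : ℝ) < J.card := Nat.cast_pos.2 (Finset.card_pos.2 ⟨j, hj⟩)
    have hmeas := 𝒜.measurable_total hπ (hY j hj) t
    refine measure_log_lt_le _ (hmeas.comp (measurable_take t.2.le)) ?_ (by positivity)
    exact (𝒜.lintegral_take_historyLaw M hπ t.2.le hmeas.exp.ennreal_ofReal).trans_le
      (𝒜.lintegral_exp_total_le_one M hπ (hY j hj) (hexp j hj) t)
  calc _ ≤ ∑ _t : Fin n, ∑ _j ∈ J, ENNReal.ofReal (δ / (n * J.card)) := by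
        rw [hunion]
        refine (measure_iUnion_fintype_le _ _).trans (Finset.sum_le_sum fun t _ => ?_)
        exact (measure_biUnion_finset_le _ _).trans (Finset.sum_le_sum fun j => htail t j)
    _ = ENNReal.ofReal (n * J.card * (δ / (n * J.card))) := by
        rw [ENNReal.ofReal_mul (by positivity)]
        simp [mul_assoc]
    _ ≤ ENNReal.ofReal δ := ENNReal.ofReal_le_ofReal <|
        (mul_div_left_comm _ _ _).trans_le (mul_le_of_le_one_right hδ.le (div_self_le_one _))

/-- The event on which the regression estimates and the regret concentrate: before each of the
rounds, the summed expected squared errors of the estimates are at most logarithmic in the numbers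
`nF` and `nP` of candidates, and the regret is controlled by its conditional means. -/
structure Concentrated (πs : C → S → A) (nF nP : ℕ) (δ : ℝ) {T : ℕ}
    (σ : Fin T → Traj C S A H) : Prop where
  rew : ∀ t : Fin T, 𝒜.total (fun π _ => M.rewDev (𝒜.rewOracle t (Fin.take t t.2.le σ)) π)
    (Fin.take t t.2.le σ) ≤ 16 * H * Real.log (3 * T * nF / δ)
  dyn : ∀ t : Fin T, 𝒜.total (fun π _ => M.dynDev (𝒜.dynOracle t (Fin.take t t.2.le σ)) π)
    (Fin.take t t.2.le σ) ≤ 32 * H * Real.log (3 * T * nP / δ)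
  regret : 𝒜.regret M πs σ ≤
    2 * 𝒜.total (fun π _ => M.meanRegret πs π) σ + H * Real.log (3 / δ)

variable [MeasurableSingletonClass C] {F : Finset (C → S → A → ℝ)}
  {Fp : Finset (C → S → A → S → ℝ)} {πs : C → S → A} {δ : ℝ}

theorem historyLaw_log_lt_regret_le (hH : 0 < H)
    (hπ : ∀ n, Measurable fun σ : Fin n → Traj C S A H => 𝒜.policy σ) (hπs : M.IsOptimal πs)
    (hδ : 0 < δ) (T : ℕ) :
    𝒜.historyLaw M T {σ | 2 * 𝒜.total (fun π _ => M.meanRegret πs π) σ + H * Real.log (1 / δ) <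
      𝒜.regret M πs σ} ≤ ENNReal.ofReal δ := by
  have hH' : (0 : ℝ) < H := Nat.cast_pos.2 hH
  let Y (π : C → S → A) (τ : Traj C S A H) : ℝ :=
    (M.val τ.1 (πs τ.1) - M.val τ.1 (π τ.1) - 2 * M.meanRegret πs π) / H
  have hY (π : C → S → A) : Measurable (Y π) :=
    (measurable_of_finite fun c =>
      (M.val c (πs c) - M.val c (π c) - 2 * M.meanRegret πs π) / H).comp measurable_fst
  have htotal (σ : Fin T → Traj C S A H) : 𝒜.total Y σ =
      (𝒜.regret M πs σ - 2 * 𝒜.total (fun π _ => M.meanRegret πs π) σ) / H := by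
    simp only [total, Y, ← Finset.sum_div, Finset.sum_sub_distrib, ← Finset.mul_sum]
    rw [← Finset.sum_sub_distrib]
    rfl
  refine (measure_mono fun σ hσ => ?_).trans
    (measure_log_lt_le _ (𝒜.measurable_total hπ hY T) (𝒜.lintegral_exp_total_le_one M hπ hY
      (M.lintegral_exp_regret_sub_meanRegret_le_one hH hπs) T) hδ)
  rw [Set.mem_ofPred_eq] at hσ ⊢
  rw [htotal, lt_div_iff₀' hH']
  linarith

variable [MeasurableSingletonClass S]

theorem historyLaw_exists_log_lt_rewDev_le (hH : 0 < H)
    (hπ : ∀ n, Measurable fun σ : Fin n → Traj C S A H => 𝒜.policy σ)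
    (hF : ∀ f ∈ F, ∀ c s a, f c s a ∈ Set.Icc 0 1) (hMF : M.meanRew ∈ F)
    (hoF : IsRewOracle F 𝒜.rewOracle) (hδ : 0 < δ) (T : ℕ) :
    𝒜.historyLaw M T {σ | ∃ t : Fin T, 16 * H * Real.log (T * F.card / δ) <
      𝒜.total (fun π _ => M.rewDev (𝒜.rewOracle t (Fin.take t t.2.le σ)) π)
        (Fin.take t t.2.le σ)} ≤ ENNReal.ofReal δ := by
  have : (0 : ℝ) < H := Nat.cast_pos.2 hH
  refine (measure_mono fun σ hσ => ?_).trans (𝒜.historyLaw_exists_log_lt_total_take_le M hπ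
    (J := F) (Y := fun f π τ => (M.rewDev f π / 2 - M.rewGap f τ) / (8 * H))
    (fun f _ π => ((M.measurable_rewGap f).const_sub _).div_const _)
    (fun f hf π => M.lintegral_exp_rewDev_sub_rewGap_le_one hH (hF f hf) π) hδ T)
  obtain ⟨t, ht⟩ := hσ
  let ρ := Fin.take t t.2.le σ
  refine ⟨t, 𝒜.rewOracle t ρ, ((hoF t).2 ρ).1, ?_⟩
  have hgap : ∑ i, M.rewGap (𝒜.rewOracle t ρ) (ρ i) ≤ 0 := by
    rw [M.sum_rewGap]
    exact sub_nonpos.2 (((hoF t).2 ρ).2 _ hMF)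
  simp only [total, ← Finset.sum_div, Finset.sum_sub_distrib] at ht ⊢
  rw [lt_div_iff₀' (by positivity)]
  linarith

theorem historyLaw_exists_log_lt_dynDev_le (hH : 0 < H)
    (hπ : ∀ n, Measurable fun σ : Fin n → Traj C S A H => 𝒜.policy σ)
    (hP : ∀ P ∈ Fp, ∀ c, IsTransition (P c)) (hMP : M.dyn ∈ Fp)
    (hoP : IsDynOracle Fp 𝒜.dynOracle) (hδ : 0 < δ) (T : ℕ) :
    𝒜.historyLaw M T {σ | ∃ t : Fin T, 32 * H * Real.log (T * Fp.card / δ) <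
      𝒜.total (fun π _ => M.dynDev (𝒜.dynOracle t (Fin.take t t.2.le σ)) π)
        (Fin.take t t.2.le σ)} ≤ ENNReal.ofReal δ := by
  have : (0 : ℝ) < H := Nat.cast_pos.2 hH
  refine (measure_mono fun σ hσ => ?_).trans (𝒜.historyLaw_exists_log_lt_total_take_le M hπ
    (J := Fp) (Y := fun P π τ => (M.dynDev P π / 2 - M.dynGap P τ) / (16 * H))
    (fun P _ π => ((M.measurable_dynGap P).const_sub _).div_const _)
    (fun P hP' π => M.lintegral_exp_dynDev_sub_dynGap_le_one hH (hP P hP') π) hδ T)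
  obtain ⟨t, ht⟩ := hσ
  let ρ := Fin.take t t.2.le σ
  refine ⟨t, 𝒜.dynOracle t ρ, ((hoP t).2 ρ).1, ?_⟩
  have hgap : ∑ i, M.dynGap (𝒜.dynOracle t ρ) (ρ i) ≤ 0 := by
    rw [M.sum_dynGap]
    exact sub_nonpos.2 (((hoP t).2 ρ).2 _ hMP)
  simp only [total, ← Finset.sum_div, Finset.sum_sub_distrib] at ht ⊢
  rw [lt_div_iff₀' (by positivity)]
  linarith

theorem le_historyLaw_concentrated (hH : 0 < H) (hF : ∀ f ∈ F, ∀ c s a, f c s a ∈ Set.Icc 0 1)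
    (hMF : M.meanRew ∈ F) (hoF : IsRewOracle F 𝒜.rewOracle)
    (hP : ∀ P ∈ Fp, ∀ c, IsTransition (P c)) (hMP : M.dyn ∈ Fp)
    (hoP : IsDynOracle Fp 𝒜.dynOracle) (hπs : M.IsOptimal πs) (hδ : 0 < δ) (T : ℕ) :
    ENNReal.ofReal (1 - δ) ≤
      𝒜.historyLaw M T {σ | 𝒜.Concentrated M πs F.card Fp.card δ σ} := by
  have hπ := 𝒜.measurable_policy hoF hoP
  have := 𝒜.isProbabilityMeasure_historyLaw M hπ T
  have hδ' : 0 < δ / 3 := by positivity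
  refine ofReal_one_sub_le_measure _ hδ.le ?_
  calc 𝒜.historyLaw M T {σ | 𝒜.Concentrated M πs F.card Fp.card δ σ}ᶜ
      ≤ ENNReal.ofReal (δ / 3) + ENNReal.ofReal (δ / 3) + ENNReal.ofReal (δ / 3) := by
        refine (measure_mono fun σ hσ => ?_).trans ((measure_union_le _ _).trans
          (add_le_add ((measure_union_le _ _).trans (add_le_add
            (𝒜.historyLaw_exists_log_lt_rewDev_le M hH hπ hF hMF hoF hδ' T)
            (𝒜.historyLaw_exists_log_lt_dynDev_le M hH hπ hP hMP hoP hδ' T)))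
            (𝒜.historyLaw_log_lt_regret_le M hH hπ hπs hδ' T)))
        by_contra hgood
        have hlog (x : ℝ) : x / (δ / 3) = 3 * x / δ := by ring
        simp only [Set.mem_union, Set.mem_ofPred_eq, not_or, not_exists, not_lt, hlog, mul_one,
          ← mul_assoc] at hgood
        exact hσ ⟨hgood.1.1, hgood.1.2, hgood.2⟩
    _ = ENNReal.ofReal δ := by
        rw [← ENNReal.ofReal_add hδ'.le hδ'.le, ← ENNReal.ofReal_add (by positivity) hδ'.le]
        ring_nf

end Alg

end Concentration

section Counting

theorem sum_range_inv_le {m T : ℕ} (hm : m ≤ T) :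
    ∑ k ∈ Finset.range m, (k : ℝ)⁻¹ ≤ 1 + Real.log T :=
  calc ∑ k ∈ Finset.range m, (k : ℝ)⁻¹
      ≤ ∑ k ∈ Finset.range (T + 1), (k : ℝ)⁻¹ :=
        Finset.sum_le_sum_of_subset_of_nonneg (Finset.range_mono (by omega))
          fun k _ _ => by positivity
    _ = (harmonic T : ℝ) := by simp [Finset.sum_range_succ', harmonic]
    _ ≤ 1 + Real.log T := harmonic_le_one_add_log T

theorem sum_inv_sum_ite_eq {A : Type*} [Fintype A] [DecidableEq A] {T : ℕ} (u : Fin T → A) :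
    ∑ t : Fin T, ((∑ i : Fin t, if u t = Fin.take t t.2.le u i then 1 else 0 : ℕ) : ℝ)⁻¹ =
      ∑ a, ∑ k ∈ Finset.range (∑ i : Fin T, if a = u i then 1 else 0), (k : ℝ)⁻¹ := by
  induction T with
  | zero => simp
  | succ T ih =>
    let v (i : Fin T) : A := u i.castSucc
    have hsplit (a : A) :
        ∑ k ∈ Finset.range (∑ i : Fin (T + 1), if a = u i then 1 else 0), (k : ℝ)⁻¹ =
          ∑ k ∈ Finset.range (∑ i : Fin T, if a = v i then 1 else 0), (k : ℝ)⁻¹ +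
            if a = u (Fin.last T) then
              ((∑ i : Fin T, if a = v i then 1 else 0 : ℕ) : ℝ)⁻¹ else 0 := by
      rw [Fin.sum_univ_castSucc]
      split_ifs
      · exact Finset.sum_range_succ _ _
      · rw [add_zero, add_zero]
    simp only [hsplit, Finset.sum_add_distrib, ← ih v, Finset.sum_ite_eq', Finset.mem_univ,
      if_true]
    exact Fin.sum_univ_castSucc _

theorem sum_inv_sum_ite_le {A : Type*} [Fintype A] [DecidableEq A] {T : ℕ} (u : Fin T → A) :
    ∑ t : Fin T, (∑ i : Fin t, if u t = Fin.take t t.2.le u i then (1 : ℝ) else 0)⁻¹ ≤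
      Fintype.card A * (1 + Real.log T) := by
  have hcount (a : A) : (∑ i : Fin T, if a = u i then 1 else 0) ≤ T :=
    (Finset.sum_le_sum fun i _ => show _ ≤ 1 by split_ifs <;> omega).trans_eq (by simp)
  calc ∑ t : Fin T, (∑ i : Fin t, if u t = Fin.take t t.2.le u i then (1 : ℝ) else 0)⁻¹
      = ∑ a, ∑ k ∈ Finset.range (∑ i : Fin T, if a = u i then 1 else 0), (k : ℝ)⁻¹ := by
        rw [← sum_inv_sum_ite_eq]
        push_cast
        rfl
    _ ≤ ∑ _a : A, (1 + Real.log T) := Finset.sum_le_sum fun a _ => sum_range_inv_le (hcount a)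
    _ = Fintype.card A * (1 + Real.log T) := by
        rw [Finset.sum_const, Finset.card_univ, nsmul_eq_mul]

end Counting

namespace Alg

section Selection

variable {C S A : Type*} [Fintype S] [Fintype A] [DecidableEq A] {H n : ℕ} (𝒜 : Alg C S A H)

theorem policySeq_congr {f f' : ℕ → C → S → A → ℝ} {P P' : ℕ → C → S → A → S → ℝ} (c : C) (n : ℕ)
    (hf : ∀ i ≤ n, f i = f' i) (hP : ∀ i ≤ n, P i = P' i) :
    𝒜.policySeq f P c n = 𝒜.policySeq f' P' c n := by
  induction n using Nat.strong_induction_on with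
  | _ n ih =>
    rw [policySeq, policySeq]
    split_ifs with hn
    · rfl
    · have hprev (i : Fin n) : 𝒜.policySeq f P c i = 𝒜.policySeq f' P' c i :=
        ih i i.2 (fun j hj => hf j (hj.trans i.2.le)) fun j hj => hP j (hj.trans i.2.le)
      simp only [hprev, hf n le_rfl, hP n le_rfl]

/-- The number of rounds of the history `ρ` whose policy plays `a` in the state `s` of the context
`c`, whether or not this state has been visited. -/
def count (ρ : Fin n → Traj C S A H) (c : C) (s : S) (a : A) : ℝ :=
  𝒜.total (fun π _ => if a = π c s then 1 else 0) ρ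

/-- The bonus that the algorithm adds to the estimated rewards after the history `ρ`. -/
def bonus (ρ : Fin n → Traj C S A H) (c : C) (s : S) (a : A) : ℝ :=
  (𝒜.β (n + 1) + H * Fintype.card S * 𝒜.γ (n + 1)) / (𝒜.pmin * 𝒜.count ρ c s a)

theorem count_nonneg (ρ : Fin n → Traj C S A H) (c : C) (s : S) (a : A) : 0 ≤ 𝒜.count ρ c s a := by
  unfold count total
  positivity

theorem policy_of_lt (ρ : Fin n → Traj C S A H) (hn : n < Fintype.card A) (c : C) (s : S) :
    𝒜.policy ρ c s = 𝒜.enum ⟨n, hn⟩ := by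
  rw [policy, policySeq, dif_pos hn]

theorem policy_of_ge (ρ : Fin n → Traj C S A H) (hn : Fintype.card A ≤ n) (c : C) :
    𝒜.policy ρ c = 𝒜.plan (𝒜.dynOracle n ρ c) fun s a =>
      𝒜.rewOracle n ρ c s a + 𝒜.bonus ρ c s a := by
  have hprev (i : Fin n) : 𝒜.policySeq
      (fun i => if hi : i ≤ n then 𝒜.rewOracle i (Fin.take i hi ρ) else 0)
      (fun i => if hi : i ≤ n then 𝒜.dynOracle i (Fin.take i hi ρ) else 0) c i =
      𝒜.policy (Fin.take i i.2.le ρ) c :=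
    𝒜.policySeq_congr c i (fun j hj => by rw [dif_pos hj, dif_pos (hj.trans i.2.le)]; rfl)
      fun j hj => by rw [dif_pos hj, dif_pos (hj.trans i.2.le)]; rfl
  rw [policy, policySeq, dif_neg hn.not_gt]
  simp only [bonus, count, total, ← hprev, dif_pos le_rfl]
  rfl

theorem one_le_count (ρ : Fin n → Traj C S A H) (hn : Fintype.card A ≤ n) (c : C) (s : S) (a : A) :
    1 ≤ 𝒜.count ρ c s a := by
  let i : Fin n := ⟨𝒜.enum.symm a, (𝒜.enum.symm a).2.trans_le hn⟩
  have hi : a = 𝒜.policy (Fin.take i i.2.le ρ) c s := by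
    rw [𝒜.policy_of_lt _ (𝒜.enum.symm a).2]
    exact (𝒜.enum.apply_symm_apply a).symm
  calc (1 : ℝ) = if a = 𝒜.policy (Fin.take i i.2.le ρ) c s then 1 else 0 := (if_pos hi).symm
    _ ≤ 𝒜.count ρ c s a := Finset.single_le_sum
        (f := fun i : Fin n => if a = 𝒜.policy (Fin.take i i.2.le ρ) c s then (1 : ℝ) else 0)
        (fun _ _ => by split_ifs <;> norm_num) (Finset.mem_univ i)

theorem sum_inv_count_le {T : ℕ} (σ : Fin T → Traj C S A H) (c : C) (s : S) :
    ∑ t : Fin T, (𝒜.count (Fin.take t t.2.le σ) c s (𝒜.policy (Fin.take t t.2.le σ) c s))⁻¹ ≤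
      Fintype.card A * (1 + Real.log T) :=
  sum_inv_sum_ite_le fun t : Fin T => 𝒜.policy (Fin.take t t.2.le σ) c s

end Selection

end Alg

section Round

theorem abs_le_div_add_mul_sq {b x : ℝ} (hb : 0 < b) (hx : 0 < x) (d : ℝ) :
    |d| ≤ b / x + x * d ^ 2 / (4 * b) := by
  rw [div_add_div _ _ hx.ne' (by positivity), le_div_iff₀ (by positivity), ← sq_abs d]
  nlinarith [sq_nonneg (2 * b - x * |d|)]

theorem sum_abs_le_div_add_mul_sum_sq {ι : Type*} [Fintype ι] [Nonempty ι] {b x : ℝ} (hb : 0 < b)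
    (hx : 0 < x) (d : ι → ℝ) :
    ∑ i, |d i| ≤ Fintype.card ι * b / x + x * (∑ i, d i ^ 2) / (4 * b) := by
  have hι : (0 : ℝ) < Fintype.card ι := Nat.cast_pos.2 Fintype.card_pos
  have hcauchy : (∑ i, |d i|) ^ 2 ≤ Fintype.card ι * ∑ i, d i ^ 2 := by
    simpa only [sq_abs, Finset.card_univ] using
      sq_sum_le_card_mul_sum_sq (s := Finset.univ) (f := fun i => |d i|)
  calc ∑ i, |d i|
      ≤ |(∑ i, |d i|)| := le_abs_self _
    _ ≤ Fintype.card ι * b / x + x * (∑ i, |d i|) ^ 2 / (4 * (Fintype.card ι * b)) :=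
        abs_le_div_add_mul_sq (mul_pos hι hb) hx _
    _ ≤ Fintype.card ι * b / x +
          x * (Fintype.card ι * ∑ i, d i ^ 2) / (4 * (Fintype.card ι * b)) := by gcongr
    _ = Fintype.card ι * b / x + x * (∑ i, d i ^ 2) / (4 * b) := by field_simp

namespace Alg

variable {C S A : Type*} [Fintype S] [Fintype A] [DecidableEq A] {H n : ℕ}
  (𝒜 : Alg C S A H) (M : CMDP C S A H) {ρ : Fin n → Traj C S A H}

/-- The part of the errors of the estimates computed from the history `ρ` that is not covered by
the bonus: squared errors, weighted by the number of times that the action was selected. -/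
def slack (ρ : Fin n → Traj C S A H) (c : C) (s : S) (a : A) : ℝ :=
  𝒜.pmin * 𝒜.count ρ c s a * (𝒜.rewOracle n ρ c s a - M.meanRew c s a) ^ 2 / (4 * 𝒜.β (n + 1)) +
    H * (𝒜.pmin * 𝒜.count ρ c s a * (∑ s', (𝒜.dynOracle n ρ c s a s' - M.dyn c s a s') ^ 2) /
      (4 * 𝒜.γ (n + 1)))

theorem modelError_le_bonus_add_slack (hp : 0 < 𝒜.pmin) (hβ : 0 < 𝒜.β (n + 1))
    (hγ : 0 < 𝒜.γ (n + 1)) (hn : Fintype.card A ≤ n) (c : C) (s : S) (a : A) :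
    modelError H (𝒜.dynOracle n ρ c) (M.dyn c) (𝒜.rewOracle n ρ c) (M.meanRew c) s a ≤
      𝒜.bonus ρ c s a + 𝒜.slack M ρ c s a := by
  have : Nonempty S := ⟨s⟩
  have hx : 0 < 𝒜.pmin * 𝒜.count ρ c s a :=
    mul_pos hp (one_pos.trans_le (𝒜.one_le_count ρ hn c s a))
  have hrew := abs_le_div_add_mul_sq hβ hx (𝒜.rewOracle n ρ c s a - M.meanRew c s a)
  have hdyn := mul_le_mul_of_nonneg_left (sum_abs_le_div_add_mul_sum_sq hγ hx fun s' =>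
    𝒜.dynOracle n ρ c s a s' - M.dyn c s a s') (Nat.cast_nonneg (α := ℝ) H)
  rw [modelError, bonus, slack, add_div]
  calc _ ≤ _ := add_le_add hrew hdyn
    _ = _ := by ring

section ContextMean

variable [Fintype C]

theorem ctxMean_total (Y : (C → S → A) → C → ℝ) (ρ : Fin n → Traj C S A H) :
    M.ctxMean (fun c => 𝒜.total (fun π _ => Y π c) ρ) =
      𝒜.total (fun π _ => M.ctxMean (Y π)) ρ :=
  M.ctxMean_sum _ _

theorem sum_ctxMean_sum_inv_count_le {T : ℕ} (σ : Fin T → Traj C S A H) :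
    ∑ t : Fin T, (M.ctxMean fun c => ∑ s,
      (𝒜.count (Fin.take t t.2.le σ) c s (𝒜.policy (Fin.take t t.2.le σ) c s))⁻¹) ≤
      Fintype.card S * Fintype.card A * (1 + Real.log T) := by
  rw [← M.ctxMean_sum]
  refine (M.ctxMean_le_ctxMean fun c => ?_).trans_eq (M.ctxMean_const _)
  rw [Finset.sum_comm]
  refine (Finset.sum_le_sum fun s _ => 𝒜.sum_inv_count_le σ c s).trans_eq ?_
  rw [Finset.sum_const, Finset.card_univ, nsmul_eq_mul, mul_assoc]

end ContextMean

variable [DecidableEq S]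

-- In each round `i`, minimum reachability turns an error at `s` for the action played there into
-- an expected error along the episode, so every selection counts, visited or not.
theorem sum_pmin_mul_count_mul_le (hp : 0 ≤ 𝒜.pmin) (hreach : M.MinReach 𝒜.pmin)
    (ρ : Fin n → Traj C S A H) (c : C) {g : S → A → ℝ} (hg : ∀ s a, 0 ≤ g s a) (π : S → A) :
    ∑ s ∈ Finset.univ.erase M.sH, 𝒜.pmin * 𝒜.count ρ c s (π s) * g s (π s) ≤
      𝒜.total (fun π' _ => value H M.s0 (M.dyn c) g (π' c)) ρ := by
  let πi (i : Fin n) : S → A := 𝒜.policy (Fin.take i i.2.le ρ) c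
  calc ∑ s ∈ Finset.univ.erase M.sH, 𝒜.pmin * 𝒜.count ρ c s (π s) * g s (π s)
      = ∑ i, 𝒜.pmin * ∑ s ∈ Finset.univ.erase M.sH, if π s = πi i s then g s (π s) else 0 := by
        simp only [count, total, Finset.mul_sum, Finset.sum_mul, mul_ite, ite_mul, mul_one,
          mul_zero, zero_mul]
        exact Finset.sum_comm
    _ ≤ ∑ i, 𝒜.pmin * ∑ s ∈ Finset.univ.erase M.sH, g s (πi i s) := by
        refine Finset.sum_le_sum fun i _ =>
          mul_le_mul_of_nonneg_left (Finset.sum_le_sum fun s _ => ?_) hp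
        split_ifs with h
        · rw [h]
        · exact hg _ _
    _ ≤ _ := Finset.sum_le_sum fun i _ =>
        mul_sum_le_value (M.isTransition c) (M.isLayering c) hg fun s => hreach c _ s

theorem sum_slack_le (hp : 0 ≤ 𝒜.pmin) (hreach : M.MinReach 𝒜.pmin) (hβ : 0 ≤ 𝒜.β (n + 1))
    (hγ : 0 ≤ 𝒜.γ (n + 1)) (c : C) (π : S → A) :
    ∑ s ∈ Finset.univ.erase M.sH, 𝒜.slack M ρ c s (π s) ≤
      𝒜.total (fun π _ => M.rewDevAt (𝒜.rewOracle n ρ) c (π c)) ρ / (4 * 𝒜.β (n + 1)) +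
        H * (𝒜.total (fun π _ => M.dynDevAt (𝒜.dynOracle n ρ) c (π c)) ρ /
          (4 * 𝒜.γ (n + 1))) := by
  simp only [slack, Finset.sum_add_distrib, ← Finset.mul_sum, ← Finset.sum_div]
  gcongr
  · exact 𝒜.sum_pmin_mul_count_mul_le M hp hreach ρ c
      (g := fun s a => (𝒜.rewOracle n ρ c s a - M.meanRew c s a) ^ 2) (fun _ _ => sq_nonneg _) π
  · exact 𝒜.sum_pmin_mul_count_mul_le M hp hreach ρ c
      (g := fun s a => ∑ s', (𝒜.dynOracle n ρ c s a s' - M.dyn c s a s') ^ 2)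
      (fun _ _ => Finset.sum_nonneg fun _ _ => sq_nonneg _) π

theorem val_sub_val_policy_le (hp : 0 < 𝒜.pmin) (hreach : M.MinReach 𝒜.pmin)
    (hplan : IsPlanner H M.s0 𝒜.plan) (hβ : 0 < 𝒜.β (n + 1)) (hγ : 0 < 𝒜.γ (n + 1))
    (hn : Fintype.card A ≤ n) {c : C} {layer : S → Fin (H + 1)}
    (hP : IsTransition (𝒜.dynOracle n ρ c))
    (hl : IsLayering M.s0 M.sH (𝒜.dynOracle n ρ c) layer) (π : S → A) :
    M.val c π - M.val c (𝒜.policy ρ c) ≤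
      2 * (𝒜.total (fun π _ => M.rewDevAt (𝒜.rewOracle n ρ) c (π c)) ρ / (4 * 𝒜.β (n + 1)) +
        H * (𝒜.total (fun π _ => M.dynDevAt (𝒜.dynOracle n ρ) c (π c)) ρ /
          (4 * 𝒜.γ (n + 1)))) +
      2 * ((𝒜.β (n + 1) + H * Fintype.card S * 𝒜.γ (n + 1)) / 𝒜.pmin *
        ∑ s, (𝒜.count ρ c s (𝒜.policy ρ c s))⁻¹) := by
  have hbonus (s : S) (a : A) : 0 ≤ 𝒜.bonus ρ c s a :=
    div_nonneg (by positivity) (mul_nonneg hp.le (𝒜.count_nonneg ρ c s a))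
  have hslack (s : S) (a : A) : 0 ≤ 𝒜.slack M ρ c s a := by
    have := 𝒜.count_nonneg ρ c s a
    unfold slack
    positivity
  have hopt := value_sub_value_le_of_optimistic hP hl (M.isTransition c) (M.meanRew_mem_Icc c)
    hbonus hslack (fun s a _ => 𝒜.modelError_le_bonus_add_slack M hp hβ hγ hn c s a)
    ((𝒜.policy_of_ge ρ hn c).symm ▸ hplan _ _ π)
  have hbonus_sum : ∑ s ∈ Finset.univ.erase M.sH, 𝒜.bonus ρ c s (𝒜.policy ρ c s) ≤
      (𝒜.β (n + 1) + H * Fintype.card S * 𝒜.γ (n + 1)) / 𝒜.pmin *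
        ∑ s, (𝒜.count ρ c s (𝒜.policy ρ c s))⁻¹ := by
    refine (Finset.sum_le_univ_sum_of_nonneg fun s => hbonus s _).trans_eq ?_
    simp only [bonus, Finset.mul_sum, ← div_eq_mul_inv, div_div]
  rw [Finset.sum_add_distrib, ← Finset.mul_sum] at hopt
  rw [CMDP.val, CMDP.val]
  linarith [𝒜.sum_slack_le M (ρ := ρ) hp.le hreach hβ.le hγ.le c π,
    𝒜.sum_slack_le M (ρ := ρ) hp.le hreach hβ.le hγ.le c (𝒜.policy ρ c)]

variable [Fintype C]

theorem meanRegret_policy_le (hp : 0 < 𝒜.pmin) (hreach : M.MinReach 𝒜.pmin)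
    (hplan : IsPlanner H M.s0 𝒜.plan) (hβ : 0 < 𝒜.β (n + 1)) (hγ : 0 < 𝒜.γ (n + 1))
    (hn : Fintype.card A ≤ n)
    (hP : ∀ c, IsTransition (𝒜.dynOracle n ρ c) ∧ ∃ layer : S → Fin (H + 1),
      IsLayering M.s0 M.sH (𝒜.dynOracle n ρ c) layer) (πs : C → S → A) :
    M.meanRegret πs (𝒜.policy ρ) ≤
      2 * (𝒜.total (fun π _ => M.rewDev (𝒜.rewOracle n ρ) π) ρ / (4 * 𝒜.β (n + 1)) +
        H * (𝒜.total (fun π _ => M.dynDev (𝒜.dynOracle n ρ) π) ρ / (4 * 𝒜.γ (n + 1)))) +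
      2 * ((𝒜.β (n + 1) + H * Fintype.card S * 𝒜.γ (n + 1)) / 𝒜.pmin *
        M.ctxMean fun c => ∑ s, (𝒜.count ρ c s (𝒜.policy ρ c s))⁻¹) := by
  refine (M.ctxMean_le_ctxMean (g := fun c =>
    2 * (𝒜.total (fun π _ => M.rewDevAt (𝒜.rewOracle n ρ) c (π c)) ρ / (4 * 𝒜.β (n + 1)) +
      H * (𝒜.total (fun π _ => M.dynDevAt (𝒜.dynOracle n ρ) c (π c)) ρ /
        (4 * 𝒜.γ (n + 1)))) +
    2 * ((𝒜.β (n + 1) + H * Fintype.card S * 𝒜.γ (n + 1)) / 𝒜.pmin *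
      ∑ s, (𝒜.count ρ c s (𝒜.policy ρ c s))⁻¹)) fun c => ?_).trans_eq ?_
  · obtain ⟨hPc, layer, hl⟩ := hP c
    exact 𝒜.val_sub_val_policy_le M hp hreach hplan hβ hγ hn hPc hl (πs c)
  · simp only [div_eq_inv_mul _ (4 * _ : ℝ), M.ctxMean_add, M.ctxMean_const_mul]
    rw [𝒜.ctxMean_total M fun π c => M.rewDevAt (𝒜.rewOracle n ρ) c (π c),
      𝒜.ctxMean_total M fun π c => M.dynDevAt (𝒜.dynOracle n ρ) c (π c)]
    rfl

end Alg

end Round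

section Parameters

theorem one_le_logp (x : ℝ) : 1 ≤ logp x := le_max_left _ _

theorem logp_pos (x : ℝ) : 0 < logp x := one_pos.trans_le (one_le_logp x)

theorem logp_le_logp {x y : ℝ} (hx : 0 < x) (hxy : x ≤ y) : logp x ≤ logp y :=
  max_le_max le_rfl (Real.log_le_log hx hxy)

theorem logp_le_log {N t : ℕ} (hN : 1 ≤ N) (ht : 1 ≤ t) {δ : ℝ} (hδ : 0 < δ) (hδ1 : δ < 1) :
    logp (N / δ) ≤ Real.log (8 * N * (t : ℝ) ^ 3 / δ) := by
  have hNδ : 1 ≤ N / δ := (one_le_div hδ).2 (hδ1.le.trans (Nat.one_le_cast.2 hN))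
  have ht3 : (1 : ℝ) ≤ (t : ℝ) ^ 3 := one_le_pow₀ (Nat.one_le_cast.2 ht)
  have hle : 8 * (N / δ) ≤ 8 * N * (t : ℝ) ^ 3 / δ := by
    rw [mul_right_comm, mul_div_assoc]
    gcongr
    linarith
  refine max_le ?_ (Real.log_le_log (by linarith) (by linarith))
  rw [Real.le_log_iff_exp_le (by linarith)]
  linarith [Real.exp_one_lt_d9]

theorem log_le_mul_logp {N T : ℕ} (hN : 1 ≤ N) (hT : 1 ≤ T) {δ : ℝ} (hδ : 0 < δ) :
    Real.log (8 * N * (T : ℝ) ^ 3 / δ) ≤ 4 * (1 + Real.log T) * logp (N / δ) := by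
  have : (0 : ℝ) < N := Nat.cast_pos.2 hN
  have : (0 : ℝ) < T := Nat.cast_pos.2 hT
  have hsplit : Real.log (8 * N * (T : ℝ) ^ 3 / δ) =
      3 * Real.log 2 + 3 * Real.log T + Real.log (N / δ) := by
    rw [show 8 * N * (T : ℝ) ^ 3 / δ = 2 ^ 3 * (T : ℝ) ^ 3 * (N / δ) by ring,
      Real.log_mul (by positivity) (by positivity), Real.log_mul (by positivity) (by positivity),
      Real.log_pow, Real.log_pow]
    norm_num
  have hlog : Real.log (N / δ) ≤ logp (N / δ) := le_max_right _ _
  nlinarith [one_le_logp (N / δ), Real.log_natCast_nonneg T, Real.log_two_lt_d9]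

theorem log_three_mul_le {N T : ℕ} (hN : 1 ≤ N) (hT : 1 ≤ T) {δ : ℝ} (hδ : 0 < δ) :
    Real.log (3 * T * N / δ) ≤ 4 * (1 + Real.log T) * logp (N / δ) := by
  have hT' : (1 : ℝ) ≤ T := Nat.one_le_cast.2 hT
  refine (Real.log_le_log (by positivity) ?_).trans (log_le_mul_logp hN hT hδ)
  rw [mul_right_comm]
  gcongr
  · norm_num
  · exact le_self_pow₀ hT' (by norm_num)

theorem log_three_div_le {N : ℕ} (hN : 1 ≤ N) {δ : ℝ} (hδ : 0 < δ) :
    Real.log (3 / δ) ≤ 4 * logp (N / δ) := by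
  have hle := log_three_mul_le hN le_rfl hδ
  simp only [Nat.cast_one, mul_one, Real.log_one, add_zero] at hle
  refine (Real.log_le_log (by positivity) ?_).trans hle
  gcongr
  exact le_mul_of_one_le_right (by norm_num) (Nat.one_le_cast.2 hN)

theorem sqrt_div_mul_sqrt_logp_le {N t : ℕ} (hN : 1 ≤ N) (ht : 1 ≤ t) {δ a κ : ℝ} (hδ : 0 < δ)
    (hδ1 : δ < 1) (ha : 0 ≤ a) (hκ : 1 ≤ κ) :
    √(t / a) * √(logp (N / δ)) ≤ √(κ * t * Real.log (8 * N * (t : ℝ) ^ 3 / δ) / a) := by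
  have hlog := logp_le_log hN ht hδ hδ1
  have hpos := logp_pos (N / δ)
  rw [← Real.sqrt_mul (by positivity), div_mul_eq_mul_div]
  gcongr
  exact le_mul_of_one_le_left (by positivity) hκ

theorem sqrt_log_div_le {N t T : ℕ} (hN : 1 ≤ N) (ht : 1 ≤ t) (htT : t ≤ T) {δ a κ : ℝ}
    (hδ : 0 < δ) (ha : 0 ≤ a) (hκ : 0 ≤ κ) (hκ' : κ ≤ 20) :
    √(κ * t * Real.log (8 * N * (t : ℝ) ^ 3 / δ) / a) ≤
      9 * (1 + Real.log T) * (√(T / a) * √(logp (N / δ))) := by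
  have hpos := logp_pos (N / δ)
  have hΛ : 1 ≤ 1 + Real.log T := le_add_of_nonneg_right (Real.log_natCast_nonneg T)
  have hlog : Real.log (8 * N * (t : ℝ) ^ 3 / δ) ≤ 4 * (1 + Real.log T) ^ 2 * logp (N / δ) :=
    calc Real.log (8 * N * (t : ℝ) ^ 3 / δ) ≤ Real.log (8 * N * (T : ℝ) ^ 3 / δ) := by gcongr
      _ ≤ 4 * (1 + Real.log T) * logp (N / δ) := log_le_mul_logp hN (ht.trans htT) hδ
      _ ≤ 4 * (1 + Real.log T) ^ 2 * logp (N / δ) := by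
        gcongr
        exact le_self_pow₀ hΛ two_ne_zero
  rw [← Real.sqrt_mul (by positivity), Real.sqrt_le_left (by positivity), mul_pow,
    Real.sq_sqrt (by positivity), div_mul_eq_mul_div, ← mul_div_assoc]
  refine div_le_div_of_nonneg_right ?_ ha
  calc κ * t * Real.log (8 * N * (t : ℝ) ^ 3 / δ)
      ≤ κ * t * (4 * (1 + Real.log T) ^ 2 * logp (N / δ)) := by gcongr
    _ ≤ 20 * T * (4 * (1 + Real.log T) ^ 2 * logp (N / δ)) := by gcongr
    _ ≤ (9 * (1 + Real.log T)) ^ 2 * (T * logp (N / δ)) := by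
      have : 0 ≤ (1 + Real.log T) ^ 2 * (T * logp (N / δ)) := by positivity
      linarith

theorem div_four_mul_le {D c Λ l a t b : ℝ} (hD : D ≤ c * (4 * Λ * l)) (hc : 0 ≤ c) (hΛ : 0 ≤ Λ)
    (hl : 0 < l) (ha : 0 < a) (ht : 0 < t) (hb : √(t / a) * √l ≤ b) :
    D / (4 * b) ≤ c * Λ * (√a * √l * (√t)⁻¹) := by
  have := Real.sqrt_pos.2 hl
  have := Real.sqrt_pos.2 ha
  have := Real.sqrt_pos.2 ht
  calc D / (4 * b) ≤ c * (4 * Λ * l) / (4 * (√(t / a) * √l)) := by gcongr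
    _ = c * Λ * (√a * √l * (√t)⁻¹) := by
      rw [Real.sqrt_div ht.le]
      field_simp
      rw [Real.sq_sqrt hl.le]

theorem sum_inv_sqrt_le (T : ℕ) : ∑ t : Fin T, (√((t + 1 : ℕ) : ℝ))⁻¹ ≤ 2 * √T := by
  rw [Fin.sum_univ_eq_sum_range (fun n => (√((n + 1 : ℕ) : ℝ))⁻¹)]
  induction T with
  | zero => simp
  | succ T ih =>
    have hpos : 0 < √((T + 1 : ℕ) : ℝ) := Real.sqrt_pos.2 (by positivity)
    have hsq : √((T + 1 : ℕ) : ℝ) ^ 2 = √(T : ℝ) ^ 2 + 1 := by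
      rw [Real.sq_sqrt (by positivity), Real.sq_sqrt (by positivity), Nat.cast_succ]
    have hstep : (√((T + 1 : ℕ) : ℝ))⁻¹ ≤ 2 * (√((T + 1 : ℕ) : ℝ) - √T) := by
      rw [inv_le_iff_one_le_mul₀ hpos]
      nlinarith [sq_nonneg (√((T + 1 : ℕ) : ℝ) - √T)]
    rw [Finset.sum_range_succ]
    linarith

theorem le_add_sqrt_mul {R X H T l : ℝ} (hH : 0 ≤ H) (hX : 0 ≤ X) (hT : 0 ≤ T) (hl : 0 ≤ l)
    (hRT : R ≤ H * T) (hRl : R ≤ X + H * l) : R ≤ X + H * √(T * l) := by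
  rcases le_total l T with h | h
  · refine hRl.trans ?_
    gcongr
    exact Real.le_sqrt_of_sq_le ((sq l).trans_le (by gcongr))
  · refine (hRT.trans ?_).trans (le_add_of_nonneg_left hX)
    gcongr
    exact Real.le_sqrt_of_sq_le ((sq T).trans_le (by gcongr))

end Parameters

section RegretBound

/-- The part of the regret bound that depends on the numbers `nF` and `nP` of elements of the reward
and the dynamics class. The dynamics carry the factor `H * nS` because their errors are summed over
the next state and each of them costs up to `H` in value. -/
def complexity (H nS nF nP : ℕ) (δ : ℝ) : ℝ :=
  √(logp (nF / δ)) + H * nS * √(logp (nP / δ))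

theorem one_le_complexity (H nS nF nP : ℕ) (δ : ℝ) : 1 ≤ complexity H nS nF nP δ :=
  le_add_of_le_of_nonneg (Real.one_le_sqrt.2 (one_le_logp _)) (by positivity)

theorem sqrt_logp_add_le_two_mul_complexity {nS : ℕ} (hS : 1 ≤ nS) (H nF nP : ℕ) (δ : ℝ) :
    √(logp (nF / δ)) + 2 * H * √(logp (nP / δ)) ≤ 2 * complexity H nS nF nP δ := by
  have hle : H * √(logp (nP / δ)) ≤ H * nS * √(logp (nP / δ)) := by
    gcongr
    exact le_mul_of_one_le_right (Nat.cast_nonneg H) (Nat.one_le_cast.2 hS)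
  rw [complexity]
  linarith [Real.sqrt_nonneg (logp (nF / δ))]

theorem sqrt_mul_complexity (H nS nA nF nP T : ℕ) (δ : ℝ) :
    √(T * (nS * nA)) * complexity H nS nF nP δ =
      H * (nS : ℝ) ^ (3 / 2 : ℝ) * √(nA * T * logp (nP / δ)) + √(T * nS * nA * logp (nF / δ)) := by
  have hrpow : (nS : ℝ) ^ (3 / 2 : ℝ) = nS * √nS := by
    rw [Real.sqrt_eq_rpow, ← Real.rpow_one_add' (Nat.cast_nonneg nS) (by norm_num)]
    norm_num
  rw [complexity, hrpow, Real.sqrt_mul' _ (logp_pos _).le, Real.sqrt_mul' _ (logp_pos _).le,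
    Real.sqrt_mul (Nat.cast_nonneg T), Real.sqrt_mul (Nat.cast_nonneg nS),
    Real.sqrt_mul (Nat.cast_nonneg nA), Real.sqrt_mul' _ (Nat.cast_nonneg nA),
    Real.sqrt_mul (Nat.cast_nonneg T)]
  ring

namespace CMDP

variable {C S A : Type*} [Fintype S] {H : ℕ} (M : CMDP C S A H)

include M

theorem one_le_card_state : 1 ≤ Fintype.card S := Fintype.card_pos_iff.2 ⟨M.s0⟩

theorem card_state_mul_card_action_pos [Fintype A] [Nonempty A] :
    (0 : ℝ) < Fintype.card S * Fintype.card A :=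
  mul_pos (Nat.cast_pos.2 M.one_le_card_state) (Nat.cast_pos.2 Fintype.card_pos)

theorem horizon_le_mul_complexity [Fintype A] {t : ℕ} (ht : t < Fintype.card A) (nF nP T : ℕ)
    (δ : ℝ) :
    H ≤ 64 * H * (1 + Real.log T) * (√(Fintype.card S * Fintype.card A) *
      complexity H (Fintype.card S) nF nP δ) * (√((t + 1 : ℕ) : ℝ))⁻¹ := by
  have hΛ : 1 ≤ 1 + Real.log T := le_add_of_nonneg_right (Real.log_natCast_nonneg T)
  have hW := one_le_complexity H (Fintype.card S) nF nP δ
  have hpos : 0 < √((t + 1 : ℕ) : ℝ) := Real.sqrt_pos.2 (by positivity)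
  have hsqrt : √((t + 1 : ℕ) : ℝ) ≤ √(Fintype.card S * Fintype.card A) := by
    refine Real.sqrt_le_sqrt ((Nat.cast_le.2 ht).trans ?_)
    exact le_mul_of_one_le_left (Nat.cast_nonneg _) (Nat.one_le_cast.2 M.one_le_card_state)
  rw [← div_eq_mul_inv, le_div_iff₀ hpos]
  calc H * √((t + 1 : ℕ) : ℝ) = 1 * H * 1 * (√((t + 1 : ℕ) : ℝ) * 1) := by ring
    _ ≤ _ := by gcongr; norm_num

end CMDP

namespace Alg

variable {C S A : Type*} [Fintype S] [Fintype A] [DecidableEq S] {H : ℕ} {𝒜 : Alg C S A H}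
  {M : CMDP C S A H}

section Regret

variable [DecidableEq A]

theorem regret_le (𝒜 : Alg C S A H) (M : CMDP C S A H) (πs : C → S → A) {T : ℕ}
    (σ : Fin T → Traj C S A H) : 𝒜.regret M πs σ ≤ H * T := by
  refine (Finset.sum_le_card_nsmul _ _ (H : ℝ) fun t _ => M.val_sub_val_le _ _ _).trans_eq ?_
  rw [Finset.card_univ, Fintype.card_fin, nsmul_eq_mul, mul_comm]

theorem regret_eq_zero_of_horizon_eq_zero (𝒜 : Alg C S A H) (M : CMDP C S A H) (hH : H = 0)
    (πs : C → S → A) {T : ℕ} (σ : Fin T → Traj C S A H) : 𝒜.regret M πs σ = 0 := by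
  subst hH
  simp only [regret, CMDP.val, value_zero, sub_self, Finset.sum_const_zero]

end Regret

variable [MeasurableSpace C] [MeasurableSpace S] [MeasurableSpace A]

/-- The setting of the theorem: minimum reachability, realizable classes `F` and `Fp` with exact
oracles, an exact planner, and the prescribed tuning parameters. -/
structure WellSpecified (𝒜 : Alg C S A H) (M : CMDP C S A H) (F : Finset (C → S → A → ℝ))
    (Fp : Finset (C → S → A → S → ℝ)) (δ : ℝ) : Prop where
  pmin_pos : 0 < 𝒜.pmin
  minReach : M.MinReach 𝒜.pmin
  rew_mem_Icc : ∀ f ∈ F, ∀ c s a, f c s a ∈ Set.Icc (0 : ℝ) 1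
  meanRew_mem : M.meanRew ∈ F
  layered : ∀ P ∈ Fp, ∀ c, IsTransition (P c) ∧
    ∃ layer : S → Fin (H + 1), IsLayering M.s0 M.sH (P c) layer
  dyn_mem : M.dyn ∈ Fp
  isRewOracle : IsRewOracle F 𝒜.rewOracle
  isDynOracle : IsDynOracle Fp 𝒜.dynOracle
  isPlanner : IsPlanner H M.s0 𝒜.plan
  delta_pos : 0 < δ
  delta_lt_one : δ < 1
  beta_eq : ∀ t, 𝒜.β t = betaParam F.card (Fintype.card S) (Fintype.card A) δ t
  gamma_eq : ∀ t, 𝒜.γ t = gammaParam Fp.card (Fintype.card S) (Fintype.card A) δ t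

namespace WellSpecified

variable {F : Finset (C → S → A → ℝ)} {Fp : Finset (C → S → A → S → ℝ)} {δ : ℝ}
  (h : 𝒜.WellSpecified M F Fp δ) {πs : C → S → A} {t T : ℕ}

include h

theorem one_le_card_rew : 1 ≤ F.card := Finset.card_pos.2 ⟨_, h.meanRew_mem⟩

theorem one_le_card_dyn : 1 ≤ Fp.card := Finset.card_pos.2 ⟨_, h.dyn_mem⟩

theorem le_beta (ht : 1 ≤ t) :
    √(t / (Fintype.card S * Fintype.card A)) * √(logp (F.card / δ)) ≤ 𝒜.β t := by
  rw [h.beta_eq]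
  exact sqrt_div_mul_sqrt_logp_le h.one_le_card_rew ht h.delta_pos h.delta_lt_one (by positivity)
    (by norm_num)

theorem le_gamma (ht : 1 ≤ t) :
    √(t / (Fintype.card S * Fintype.card A)) * √(logp (Fp.card / δ)) ≤ 𝒜.γ t := by
  rw [h.gamma_eq]
  exact sqrt_div_mul_sqrt_logp_le h.one_le_card_dyn ht h.delta_pos h.delta_lt_one (by positivity)
    (by norm_num)

theorem beta_add_gamma_le (ht : 1 ≤ t) (htT : t ≤ T) :
    𝒜.β t + H * Fintype.card S * 𝒜.γ t ≤
      9 * (1 + Real.log T) * (√(T / (Fintype.card S * Fintype.card A)) *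
        complexity H (Fintype.card S) F.card Fp.card δ) := by
  have hβ : 𝒜.β t ≤ 9 * (1 + Real.log T) *
      (√(T / (Fintype.card S * Fintype.card A)) * √(logp (F.card / δ))) := by
    rw [h.beta_eq]
    exact sqrt_log_div_le h.one_le_card_rew ht htT h.delta_pos (by positivity) (by norm_num)
      (by norm_num)
  have hγ : 𝒜.γ t ≤ 9 * (1 + Real.log T) *
      (√(T / (Fintype.card S * Fintype.card A)) * √(logp (Fp.card / δ))) := by
    rw [h.gamma_eq]
    exact sqrt_log_div_le h.one_le_card_dyn ht htT h.delta_pos (by positivity) (by norm_num)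
      (by norm_num)
  refine (add_le_add hβ (mul_le_mul_of_nonneg_left hγ (by positivity))).trans_eq ?_
  rw [complexity]
  ring

variable [Nonempty A]

theorem beta_pos (ht : 1 ≤ t) : 0 < 𝒜.β t :=
  (mul_pos (Real.sqrt_pos.2 (div_pos (Nat.cast_pos.2 ht) M.card_state_mul_card_action_pos))
    (Real.sqrt_pos.2 (logp_pos _))).trans_le (h.le_beta ht)

theorem gamma_pos (ht : 1 ≤ t) : 0 < 𝒜.γ t :=
  (mul_pos (Real.sqrt_pos.2 (div_pos (Nat.cast_pos.2 ht) M.card_state_mul_card_action_pos))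
    (Real.sqrt_pos.2 (logp_pos _))).trans_le (h.le_gamma ht)

variable [Fintype C] [DecidableEq A]

theorem total_rewDev_div_le {σ : Fin T → Traj C S A H}
    (hσ : 𝒜.Concentrated M πs F.card Fp.card δ σ) (t : Fin T) :
    𝒜.total (fun π _ => M.rewDev (𝒜.rewOracle t (Fin.take t t.2.le σ)) π) (Fin.take t t.2.le σ) /
      (4 * 𝒜.β (t + 1)) ≤ 16 * H * (1 + Real.log T) *
        (√(Fintype.card S * Fintype.card A) * √(logp (F.card / δ)) * (√((t + 1 : ℕ) : ℝ))⁻¹) := by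
  have hlog := log_three_mul_le (T := T) h.one_le_card_rew t.pos h.delta_pos
  exact div_four_mul_le ((hσ.rew t).trans (by gcongr)) (by positivity)
    (add_nonneg zero_le_one (Real.log_natCast_nonneg T)) (logp_pos _)
    M.card_state_mul_card_action_pos (by positivity) (h.le_beta (Nat.le_add_left 1 t))

theorem total_dynDev_div_le {σ : Fin T → Traj C S A H}
    (hσ : 𝒜.Concentrated M πs F.card Fp.card δ σ) (t : Fin T) :
    𝒜.total (fun π _ => M.dynDev (𝒜.dynOracle t (Fin.take t t.2.le σ)) π) (Fin.take t t.2.le σ) /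
      (4 * 𝒜.γ (t + 1)) ≤ 32 * H * (1 + Real.log T) *
        (√(Fintype.card S * Fintype.card A) * √(logp (Fp.card / δ)) * (√((t + 1 : ℕ) : ℝ))⁻¹) := by
  have hlog := log_three_mul_le (T := T) h.one_le_card_dyn t.pos h.delta_pos
  exact div_four_mul_le ((hσ.dyn t).trans (by gcongr)) (by positivity)
    (add_nonneg zero_le_one (Real.log_natCast_nonneg T)) (logp_pos _)
    M.card_state_mul_card_action_pos (by positivity) (h.le_gamma (Nat.le_add_left 1 t))

-- The first `|A|` rounds need no separate account: their regret, at most `H` each, obeys the bound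
-- of the later rounds.
theorem meanRegret_policy_le {σ : Fin T → Traj C S A H}
    (hσ : 𝒜.Concentrated M πs F.card Fp.card δ σ) (t : Fin T) :
    M.meanRegret πs (𝒜.policy (Fin.take t t.2.le σ)) ≤
      64 * H * (1 + Real.log T) * (√(Fintype.card S * Fintype.card A) *
        complexity H (Fintype.card S) F.card Fp.card δ) * (√((t + 1 : ℕ) : ℝ))⁻¹ +
      18 * (1 + Real.log T) / 𝒜.pmin * (√(T / (Fintype.card S * Fintype.card A)) *
        complexity H (Fintype.card S) F.card Fp.card δ) *
          M.ctxMean fun c => ∑ s,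
            (𝒜.count (Fin.take t t.2.le σ) c s (𝒜.policy (Fin.take t t.2.le σ) c s))⁻¹ := by
  have hmean : 0 ≤ M.ctxMean fun c => ∑ s,
      (𝒜.count (Fin.take t t.2.le σ) c s (𝒜.policy (Fin.take t t.2.le σ) c s))⁻¹ :=
    (M.ctxMean_const 0).ge.trans <| M.ctxMean_le_ctxMean fun c =>
      Finset.sum_nonneg fun s _ => inv_nonneg.2 (𝒜.count_nonneg _ c s _)
  have hp := h.pmin_pos
  have hW := one_le_complexity H (Fintype.card S) F.card Fp.card δ
  have := Real.log_natCast_nonneg T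
  rcases lt_or_ge (t : ℕ) (Fintype.card A) with ht | ht
  · refine le_add_of_le_of_nonneg ?_ (by positivity)
    exact ((M.ctxMean_le_ctxMean fun c => M.val_sub_val_le c _ _).trans_eq
      (M.ctxMean_const _)).trans (M.horizon_le_mul_complexity ht _ _ T δ)
  have ht1 : 1 ≤ (t : ℕ) + 1 := Nat.le_add_left 1 t
  refine (𝒜.meanRegret_policy_le M hp h.minReach h.isPlanner (h.beta_pos ht1) (h.gamma_pos ht1) ht
    (h.layered _ ((h.isDynOracle t).2 _).1) πs).trans (add_le_add ?_ ?_)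
  · calc _ ≤ 2 * (16 * H * (1 + Real.log T) * (√(Fintype.card S * Fintype.card A) *
          √(logp (F.card / δ)) * (√((t + 1 : ℕ) : ℝ))⁻¹) + H * (32 * H * (1 + Real.log T) *
          (√(Fintype.card S * Fintype.card A) * √(logp (Fp.card / δ)) *
            (√((t + 1 : ℕ) : ℝ))⁻¹))) := by
          gcongr
          · exact h.total_rewDev_div_le hσ t
          · exact h.total_dynDev_div_le hσ t
      _ = 32 * H * (1 + Real.log T) * (√(Fintype.card S * Fintype.card A) *
          (√(logp (F.card / δ)) + 2 * H * √(logp (Fp.card / δ)))) *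
            (√((t + 1 : ℕ) : ℝ))⁻¹ := by ring
      _ ≤ 32 * H * (1 + Real.log T) * (√(Fintype.card S * Fintype.card A) *
          (2 * complexity H (Fintype.card S) F.card Fp.card δ)) * (√((t + 1 : ℕ) : ℝ))⁻¹ := by
          gcongr
          exact sqrt_logp_add_le_two_mul_complexity M.one_le_card_state H _ _ δ
      _ = _ := by ring
  · calc _ ≤ 2 * (9 * (1 + Real.log T) * (√(T / (Fintype.card S * Fintype.card A)) *
          complexity H (Fintype.card S) F.card Fp.card δ) / 𝒜.pmin * _) := by
          gcongr
          exact h.beta_add_gamma_le ht1 t.2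
      _ = _ := by ring

theorem total_meanRegret_le {σ : Fin T → Traj C S A H}
    (hσ : 𝒜.Concentrated M πs F.card Fp.card δ σ) :
    𝒜.total (fun π _ => M.meanRegret πs π) σ ≤
      128 * (1 + Real.log T) ^ 2 * ((H + 1 / 𝒜.pmin) *
        (√(T * (Fintype.card S * Fintype.card A)) *
          complexity H (Fintype.card S) F.card Fp.card δ)) := by
  have ha := M.card_state_mul_card_action_pos (A := A)
  have hp := h.pmin_pos
  have hW := one_le_complexity H (Fintype.card S) F.card Fp.card δ
  have hlog := Real.log_natCast_nonneg T
  have hcounts := 𝒜.sum_ctxMean_sum_inv_count_le M σ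
  have hsqrt : √(T / (Fintype.card S * Fintype.card A)) * (Fintype.card S * Fintype.card A) =
      √(T * (Fintype.card S * Fintype.card A)) := by
    rw [Real.sqrt_div' _ ha.le, Real.sqrt_mul' _ ha.le, div_mul_eq_mul_div, mul_div_assoc,
      Real.div_sqrt]
  refine (Finset.sum_le_sum fun t _ => h.meanRegret_policy_le hσ t).trans ?_
  rw [Finset.sum_add_distrib, ← Finset.mul_sum, ← Finset.mul_sum]
  calc _ ≤ 64 * H * (1 + Real.log T) * (√(Fintype.card S * Fintype.card A) *
          complexity H (Fintype.card S) F.card Fp.card δ) * (2 * √T) +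
        18 * (1 + Real.log T) / 𝒜.pmin * (√(T / (Fintype.card S * Fintype.card A)) *
          complexity H (Fintype.card S) F.card Fp.card δ) *
            (Fintype.card S * Fintype.card A * (1 + Real.log T)) := by
        gcongr
        exact sum_inv_sqrt_le T
    _ = 128 * (1 + Real.log T) * (H * (√T * √(Fintype.card S * Fintype.card A) *
          complexity H (Fintype.card S) F.card Fp.card δ)) +
        18 * (1 + Real.log T) ^ 2 * (1 / 𝒜.pmin * (√(T / (Fintype.card S * Fintype.card A)) *
          (Fintype.card S * Fintype.card A) *
            complexity H (Fintype.card S) F.card Fp.card δ)) := by ring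
    _ ≤ 128 * (1 + Real.log T) ^ 2 * (H * (√(T * (Fintype.card S * Fintype.card A)) *
          complexity H (Fintype.card S) F.card Fp.card δ)) +
        128 * (1 + Real.log T) ^ 2 * (1 / 𝒜.pmin * (√(T * (Fintype.card S * Fintype.card A)) *
          complexity H (Fintype.card S) F.card Fp.card δ)) := by
        rw [hsqrt, ← Real.sqrt_mul' _ ha.le]
        gcongr
        · exact le_self_pow₀ (le_add_of_nonneg_right hlog) two_ne_zero
        · norm_num
    _ = _ := by ring

theorem regret_le_of_concentrated {σ : Fin T → Traj C S A H}
    (hσ : 𝒜.Concentrated M πs F.card Fp.card δ σ) :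
    𝒜.regret M πs σ ≤ 260 * (1 + Real.log T) ^ 2 * ((H + 1 / 𝒜.pmin) *
      (√(T * (Fintype.card S * Fintype.card A)) *
        complexity H (Fintype.card S) F.card Fp.card δ)) := by
  have hp := h.pmin_pos
  have hl := logp_pos (F.card / δ)
  have hΛ : 1 ≤ 1 + Real.log T := le_add_of_nonneg_right (Real.log_natCast_nonneg T)
  set Y := (H + 1 / 𝒜.pmin) * (√(T * (Fintype.card S * Fintype.card A)) *
    complexity H (Fintype.card S) F.card Fp.card δ) with hY
  have hHY : H * √(T * logp (F.card / δ)) ≤ Y := by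
    have ha : (1 : ℝ) ≤ Fintype.card S * Fintype.card A := by
      exact_mod_cast Nat.mul_pos M.one_le_card_state Fintype.card_pos
    rw [Real.sqrt_mul (Nat.cast_nonneg T), hY]
    gcongr
    · exact le_add_of_nonneg_right (by positivity)
    · exact le_mul_of_one_le_right (Nat.cast_nonneg T) ha
    · exact le_add_of_nonneg_right (by positivity)
  have hY0 : 0 ≤ Y := hHY.trans' (by positivity)
  have hHT : (0 : ℝ) ≤ H * T := by positivity
  have hmean := h.total_meanRegret_le hσ
  have hlog := mul_le_mul_of_nonneg_left (log_three_div_le h.one_le_card_rew h.delta_pos)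
    (Nat.cast_nonneg (α := ℝ) H)
  calc 𝒜.regret M πs σ
      ≤ 256 * (1 + Real.log T) ^ 2 * Y + 4 * H * √(T * logp (F.card / δ)) :=
        le_add_sqrt_mul (by positivity) (by positivity) (Nat.cast_nonneg T) hl.le
          (by linarith [𝒜.regret_le M πs σ, hHT]) (by linarith [hσ.regret])
    _ ≤ 256 * (1 + Real.log T) ^ 2 * Y + 4 * ((1 + Real.log T) ^ 2 * Y) := by
        rw [mul_assoc 4]
        gcongr _ + 4 * ?_
        exact hHY.trans (le_mul_of_one_le_left hY0 (one_le_pow₀ hΛ))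
    _ = 260 * (1 + Real.log T) ^ 2 * Y := by ring

theorem le_historyLaw_regret_le [MeasurableSingletonClass C] [MeasurableSingletonClass S]
    [MeasurableSingletonClass A] (hπs : M.IsOptimal πs) {B : ℝ} (hB : 0 ≤ B)
    (hle : 0 < H → (H + 1 / 𝒜.pmin) * (H * (Fintype.card S : ℝ) ^ (3 / 2 : ℝ) *
      √(Fintype.card A * T * logp (Fp.card / δ)) +
        √(T * Fintype.card S * Fintype.card A * logp (F.card / δ))) ≤ 2 * B) :
    ENNReal.ofReal (1 - δ) ≤ 𝒜.historyLaw M T {σ | 𝒜.regret M πs σ ≤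
      520 * (1 + Real.log T) ^ 2 * B} := by
  have hπ := 𝒜.measurable_policy h.isRewOracle h.isDynOracle
  have := 𝒜.isProbabilityMeasure_historyLaw M hπ T
  rcases H.eq_zero_or_pos with hH | hH
  · have huniv : {σ | 𝒜.regret M πs σ ≤ 520 * (1 + Real.log T) ^ 2 * B} =
        (Set.univ : Set (Fin T → Traj C S A H)) := Set.eq_univ_of_forall fun σ =>
      (𝒜.regret_eq_zero_of_horizon_eq_zero M hH πs σ).trans_le (by positivity)
    rw [huniv, measure_univ]
    exact ENNReal.ofReal_le_one.2 (sub_le_self _ h.delta_pos.le)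
  · refine (𝒜.le_historyLaw_concentrated M hH h.rew_mem_Icc h.meanRew_mem h.isRewOracle
      (fun P hP c => (h.layered P hP c).1) h.dyn_mem h.isDynOracle hπs h.delta_pos T).trans
        (measure_mono fun σ hσ => (h.regret_le_of_concentrated hσ).trans ?_)
    rw [sqrt_mul_complexity]
    calc _ ≤ 260 * (1 + Real.log T) ^ 2 * (2 * B) :=
          mul_le_mul_of_nonneg_left (hle hH) (by positivity)
      _ = _ := by ring

end WellSpecified

end Alg

end RegretBound

section ProductClass

theorem card_le_pow_of_forall_mem {C S A : Type*} [Fintype S] {F : Finset (C → S → A → ℝ)}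
    {G : Finset (C → A → ℝ)} (h : ∀ f ∈ F, ∀ s, (fun c a => f c s a) ∈ G) :
    F.card ≤ G.card ^ Fintype.card S := by
  classical
  calc F.card ≤ (Fintype.piFinset fun _ : S => G).card := by
        refine Finset.card_le_card_of_injOn (fun f s c a => f c s a)
          (fun f hf => Fintype.mem_piFinset.2 fun s => h f hf s) fun f _ g _ hfg => ?_
        funext c s a
        exact congrFun (congrFun (congrFun hfg s) c) a
    _ = G.card ^ Fintype.card S := by
        rw [Fintype.card_piFinset, Finset.prod_const, Finset.card_univ]

theorem logp_le_mul_logp_of_le_pow {N G n : ℕ} (hN : 0 < N) (hn : 0 < n) (h : N ≤ G ^ n) {δ : ℝ}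
    (hδ : 0 < δ) (hδ1 : δ ≤ 1) : logp (N / δ) ≤ n * logp (G / δ) := by
  have : (0 : ℝ) < N := Nat.cast_pos.2 hN
  have hpow : (N : ℝ) / δ ≤ (G / δ) ^ n := by
    rw [div_pow]
    gcongr
    · exact_mod_cast h
    · exact pow_le_of_le_one hδ.le hδ1 hn.ne'
  refine max_le (one_le_mul_of_one_le_of_one_le (Nat.one_le_cast.2 hn) (one_le_logp _)) ?_
  calc Real.log (N / δ) ≤ Real.log ((G / δ) ^ n) := Real.log_le_log (by positivity) hpow
    _ = n * Real.log (G / δ) := Real.log_pow _ _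
    _ ≤ n * logp (G / δ) := by
        gcongr
        exact le_max_right _ _

theorem sqrt_logp_le_mul_sqrt_logp {N G n : ℕ} (hN : 0 < N) (hn : 0 < n) (h : N ≤ G ^ n) {δ : ℝ}
    (hδ : 0 < δ) (hδ1 : δ ≤ 1) (T nA : ℕ) :
    √(T * n * nA * logp (N / δ)) ≤ n * √(T * nA * logp (G / δ)) := by
  have hl := logp_pos (G / δ)
  rw [Real.sqrt_le_left (by positivity), mul_pow, Real.sq_sqrt (by positivity)]
  calc T * n * nA * logp (N / δ) ≤ T * n * nA * (n * logp (G / δ)) := by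
        gcongr
        exact logp_le_mul_logp_of_le_pow hN hn h hδ hδ1
    _ = (n : ℝ) ^ 2 * (T * nA * logp (G / δ)) := by ring

theorem sqrt_logp_add_le_two_mul_sqrt_logp_max {H nS nG nP : ℕ} (hH : 0 < H) (hS : 0 < nS)
    (hG : 0 < nG) (hP : 0 < nP) {δ : ℝ} (hδ : 0 < δ) (nA T : ℕ) :
    H * (nS : ℝ) ^ (3 / 2 : ℝ) * √(nA * T * logp (nP / δ)) + nS * √(T * nA * logp (nG / δ)) ≤
      2 * (H * (nS : ℝ) ^ (3 / 2 : ℝ) * √(nA * T * logp ((max nG nP : ℕ) / δ))) := by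
  have : (0 : ℝ) < nP := Nat.cast_pos.2 hP
  have : (0 : ℝ) < nG := Nat.cast_pos.2 hG
  have hlP : logp (nP / δ) ≤ logp ((max nG nP : ℕ) / δ) :=
    logp_le_logp (by positivity) (by gcongr; exact le_max_right _ _)
  have hlG : logp (nG / δ) ≤ logp ((max nG nP : ℕ) / δ) :=
    logp_le_logp (by positivity) (by gcongr; exact le_max_left _ _)
  have hrpow : (nS : ℝ) ≤ H * (nS : ℝ) ^ (3 / 2 : ℝ) :=
    (Real.self_le_rpow_of_one_le (Nat.one_le_cast.2 hS) (by norm_num)).trans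
      (le_mul_of_one_le_left (by positivity) (Nat.one_le_cast.2 hH))
  rw [two_mul, mul_comm (T : ℝ)]
  gcongr

end ProductClass

end UCDD

end

theorem mainTheorem3 :
    ∃ (K : ℝ) (k : ℕ), 0 < K ∧
      ∀ (C S A : Type*) [Fintype C] [Fintype S] [Fintype A] [Nonempty A]
        [DecidableEq S] [DecidableEq A]
        [MeasurableSpace C] [MeasurableSingletonClass C]
        [MeasurableSpace S] [MeasurableSingletonClass S]
        [MeasurableSpace A] [MeasurableSingletonClass A]
        (H : ℕ) (M : UCDD.CMDP C S A H)
        (F : Finset (C → S → A → ℝ)) (Fp : Finset (C → S → A → S → ℝ))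
        (𝒜 : UCDD.Alg C S A H) (πs : C → S → A) (δ : ℝ) (T : ℕ),
        -- minimum reachability, with a parameter known to the algorithm
        0 < 𝒜.pmin → 𝒜.pmin ≤ 1 → M.MinReach 𝒜.pmin →
        -- the reward class: functions into [0,1], realizable
        (∀ f ∈ F, ∀ c s a, f c s a ∈ Set.Icc (0 : ℝ) 1) → M.meanRew ∈ F →
        -- the dynamics class: layered dynamics for every context, realizable
        (∀ P ∈ Fp, ∀ c, UCDD.IsTransition (P c) ∧
          ∃ layer : S → Fin (H + 1), UCDD.IsLayering M.s0 M.sH (P c) layer) →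
        M.dyn ∈ Fp →
        -- the oracles, the planner and the tuning parameters
        UCDD.IsRewOracle F 𝒜.rewOracle → UCDD.IsDynOracle Fp 𝒜.dynOracle →
        UCDD.IsPlanner H M.s0 𝒜.plan →
        0 < δ → δ < 1 →
        (∀ t, 𝒜.β t = UCDD.betaParam F.card (Fintype.card S) (Fintype.card A) δ t) →
        (∀ t, 𝒜.γ t = UCDD.gammaParam Fp.card (Fintype.card S) (Fintype.card A) δ t) →
        M.IsOptimal πs → 1 ≤ T →
        -- the bound in terms of F and Fp
        ENNReal.ofReal (1 - δ) ≤ 𝒜.historyLaw M T {σ | 𝒜.regret M πs σ ≤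
          K * (1 + Real.log T) ^ k *
            ((H + 1 / 𝒜.pmin) *
              (H * (Fintype.card S : ℝ) ^ (3 / 2 : ℝ) *
                  √(Fintype.card A * T * UCDD.logp (Fp.card / δ))
                + √(T * Fintype.card S * Fintype.card A * UCDD.logp (F.card / δ)))
              + Fintype.card A * H)} ∧
        -- the bounds in terms of G, where F = G^S
        ∀ G : Finset (C → A → ℝ), (∀ f, f ∈ F ↔ ∀ s, (fun c a => f c s a) ∈ G) →
          ENNReal.ofReal (1 - δ) ≤ 𝒜.historyLaw M T {σ | 𝒜.regret M πs σ ≤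
            K * (1 + Real.log T) ^ k *
              ((H + 1 / 𝒜.pmin) *
                (H * (Fintype.card S : ℝ) ^ (3 / 2 : ℝ) *
                    √(T * Fintype.card A * UCDD.logp (Fp.card / δ))
                  + Fintype.card S * √(T * Fintype.card A * UCDD.logp (G.card / δ)))
                + Fintype.card A * H)} ∧
          ENNReal.ofReal (1 - δ) ≤ 𝒜.historyLaw M T {σ | 𝒜.regret M πs σ ≤
            K * (1 + Real.log T) ^ k *
              ((H + 1 / 𝒜.pmin) * (H * (Fintype.card S : ℝ) ^ (3 / 2 : ℝ) *
                √(Fintype.card A * T * UCDD.logp ((max G.card Fp.card : ℕ) / δ))))} := by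
  refine ⟨520, 2, by norm_num, ?_⟩
  intro C S A _ _ _ _ _ _ _ _ _ _ _ _ H M F Fp 𝒜 πs δ T hp _ hreach hF hMF hP hMP hoF hoP hplan
    hδ hδ1 hβ hγ hπs _
  have h : 𝒜.WellSpecified M F Fp δ :=
    ⟨hp, hreach, hF, hMF, hP, hMP, hoF, hoP, hplan, hδ, hδ1, hβ, hγ⟩
  refine ⟨h.le_historyLaw_regret_le hπs (by positivity) fun _ => ?_, fun G hG => ?_⟩
  · exact (le_add_of_nonneg_right (by positivity)).trans
      (le_mul_of_one_le_left (by positivity) one_le_two)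
  have hclass := UCDD.sqrt_logp_le_mul_sqrt_logp h.one_le_card_rew M.one_le_card_state
    (UCDD.card_le_pow_of_forall_mem fun f hf => (hG f).1 hf) hδ hδ1.le T (Fintype.card A)
  refine ⟨h.le_historyLaw_regret_le hπs (by positivity) fun _ => ?_,
    h.le_historyLaw_regret_le hπs (by positivity) fun hH => ?_⟩
  · refine (le_add_of_le_of_nonneg ?_ (by positivity)).trans
      (le_mul_of_one_le_left (by positivity) one_le_two)
    rw [mul_comm (Fintype.card A : ℝ) (T : ℝ)]
    gcongr
  · have hGcard : 0 < G.card := Finset.card_pos.2 ⟨_, (hG _).1 hMF M.s0⟩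
    rw [mul_left_comm]
    gcongr
    exact (add_le_add_right hclass _).trans (UCDD.sqrt_logp_add_le_two_mul_sqrt_logp_max hH
      M.one_le_card_state hGcard h.one_le_card_dyn hδ _ T)
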